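/- For a real random variable $U$ let $\|U\|_{\psi_2}=\inf\{t>0:\mathbb{E}\exp(U^2/t^2)\le 2\}$, and for a nonzero positive semi-definite matrix $\Sigma$ let $\mathrm{r_e}(\Sigma)=\mathrm{tr}(\Sigma)/\|\Sigma\|$, with $\|\cdot\|$ the operator norm, be its effective rank. Let $(X,y)\in\mathbb{R}^p\times\mathbb{R}$ be a random pair, let $\Sigma_X$ be the covariance matrix of $X$, and let $\sigma_y^2=\mathbb{E}[y^2]>0$. Suppose that $X=\Sigma_X^{1/2}\tilde X$ and $y=\sigma_y\tilde y$, where $\tilde X$ has independent entries, and the entries of $\tilde X$ as well as $\tilde y$ have zero mean, unit variance and $\psi_2$-norm at most $M$ (the dependence between $\tilde X$ and $\tilde y$ is arbitrary). Let $(X_1,y_1),\dots,(X_n,y_n)$ be i.i.d. copies of $(X,y)$, let $\mathbf{X}\in\mathbb{R}^{n\times p}$ be the matrix with rows $X_1,\dots,X_n$, let $\mathbf{y}=(y_1,\dots,y_n)^\top$, and let $$\widehat\alpha=\arg\min\{\|\alpha\|:\ \|\mathbf{X}\alpha-\mathbf{y}\|=\min_{u\in\mathbb{R}^p}\|\mathbf{X}u-\mathbf{y}\|\}$$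 be the minimum-norm least-squares estimator. For $\alpha\in\mathbb{R}^p$ let $R(\alpha)=\mathbb{E}[(X^\top\alpha-y)^2]$, where the expectation is over the pair $(X,y)$ only, so that $R(\widehat\alpha)$ is a function of the sample. (i) For every $M>0$ there are constants $C>1$ and $c,c',K>0$, depending only on $M$, such that for all $n$, all $p$ and all distributions of $(X,y)$ as above with $\mathrm{r_e}(\Sigma_X)>C\,n$, with probability at least $1-c\,e^{-c'n}$, $$\left|\frac{R(\widehat\alpha)}{R(\mathbf{0})}-1\right|\le K\sqrt{\frac{n}{\mathrm{r_e}(\Sigma_X)}}.$$ (ii) Consequently, along every sequence of such problems, with a common $M$, for which $n\to\infty$ and $\mathrm{r_e}(\Sigma_X)/n\to\infty$, the ratio $R(\widehat\alpha)/R(\mathbf{0})$ converges to $1$ in probability, so that $\widehat\alpha$ asymptotically does no better than predicting by zero. -/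

import Mathlib

open MeasureTheory ProbabilityTheory Filter
open scoped ENNReal Topology MatrixOrder

universe u v

noncomputable section

namespace NullRisk

/-- The sub-Gaussian (`ψ₂`) norm `inf {t > 0 : E exp(U² / t²) ≤ 2}`, with value `∞` when no such
`t` exists. -/
def psi2Norm {Ω : Type*} [MeasurableSpace Ω] (Q : Measure Ω) (U : Ω → ℝ) : ℝ≥0∞ :=
  sInf {s | ∃ t : ℝ, 0 < t ∧ ∫⁻ ω, ENNReal.ofReal (Real.exp (U ω ^ 2 / t ^ 2)) ∂Q ≤ 2 ∧
    s = ENNReal.ofReal t}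

/-- The covariance matrix of a random vector. -/
def covMatrix {Ω : Type*} [MeasurableSpace Ω] {p : ℕ} (Q : Measure Ω)
    (X : Ω → EuclideanSpace ℝ (Fin p)) : Matrix (Fin p) (Fin p) ℝ :=
  Matrix.of fun i j => cov[fun ω => X ω i, fun ω => X ω j; Q]

/-- The effective rank `tr(S) / ‖S‖`, with `‖S‖` the Euclidean operator norm. -/
def effectiveRank {p : ℕ} (S : Matrix (Fin p) (Fin p) ℝ) : ℝ :=
  S.trace / ‖Matrix.toEuclideanCLM (𝕜 := ℝ) S‖

/-- The prediction risk `R(α) = E[(Xᵀα - y)²]` of a fixed weight vector `α`. -/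
def risk {Ω : Type*} [MeasurableSpace Ω] {p : ℕ} (Q : Measure Ω)
    (X : Ω → EuclideanSpace ℝ (Fin p)) (y : Ω → ℝ) (α : EuclideanSpace ℝ (Fin p)) : ℝ :=
  ∫ ω, (inner ℝ (X ω) α - y ω) ^ 2 ∂Q

/-- `α` minimizes `u ↦ ‖A u - b‖`. -/
def IsLeastSquares {n p : ℕ} (A : Matrix (Fin n) (Fin p) ℝ) (b : EuclideanSpace ℝ (Fin n))
    (α : EuclideanSpace ℝ (Fin p)) : Prop :=
  ∀ u : EuclideanSpace ℝ (Fin p), ‖Matrix.toEuclideanLin A α - b‖ ≤ ‖Matrix.toEuclideanLin A u - b‖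

/-- `α` has the smallest norm among the minimizers of `u ↦ ‖A u - b‖`. -/
def IsMinNormLeastSquares {n p : ℕ} (A : Matrix (Fin n) (Fin p) ℝ)
    (b : EuclideanSpace ℝ (Fin n)) (α : EuclideanSpace ℝ (Fin p)) : Prop :=
  IsLeastSquares A b α ∧ ∀ β, IsLeastSquares A b β → ‖α‖ ≤ ‖β‖

theorem existsUnique_isMinNormLeastSquares {n p : ℕ} (A : Matrix (Fin n) (Fin p) ℝ)
    (b : EuclideanSpace ℝ (Fin n)) : ∃! α, IsMinNormLeastSquares A b α := by
  set L := Matrix.toEuclideanLin A with hL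
  have hcont : Continuous L := LinearMap.continuous_of_finiteDimensional L
  have hne : ∃ α, IsLeastSquares A b α := by
    have hcl : IsClosed (LinearMap.range L : Set (EuclideanSpace ℝ (Fin n))) :=
      Submodule.closed_of_finiteDimensional _
    obtain ⟨z, ⟨α, rfl⟩, hz⟩ := hcl.exists_infDist_eq_dist ⟨0, Submodule.zero_mem _⟩ b
    refine ⟨α, fun u => ?_⟩
    have h : Metric.infDist b (LinearMap.range L : Set (EuclideanSpace ℝ (Fin n))) ≤
        dist b (L u) := Metric.infDist_le_dist_of_mem ⟨u, rfl⟩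
    rw [hz, dist_comm, dist_comm b, dist_eq_norm, dist_eq_norm] at h
    exact h
  have hclosed : IsClosed {α | IsLeastSquares A b α} := by
    simp only [IsLeastSquares, Set.ofPred_forall]
    exact isClosed_iInter fun u =>
      isClosed_le ((hcont.sub continuous_const).norm) continuous_const
  obtain ⟨α, hα, hmin⟩ := hclosed.exists_infDist_eq_dist hne 0
  replace hα : IsLeastSquares A b α := hα
  have hαmin : IsMinNormLeastSquares A b α := by
    refine ⟨hα, fun β hβ => ?_⟩
    have h := Metric.infDist_le_dist_of_mem (x := (0 : EuclideanSpace ℝ (Fin p)))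
      (show β ∈ {α | IsLeastSquares A b α} from Set.mem_ofPred.mpr hβ)
    rw [hmin] at h
    simpa using h
  refine ⟨α, hαmin, fun β hβ => ?_⟩
  have hnorm : ‖β‖ = ‖α‖ := le_antisymm (hβ.2 α hα) (hαmin.2 β hβ.1)
  have hmid : IsLeastSquares A b ((2⁻¹ : ℝ) • (α + β)) := by
    intro u
    have e : L ((2⁻¹ : ℝ) • (α + β)) - b
        = (2⁻¹ : ℝ) • (L α - b) + (2⁻¹ : ℝ) • (L β - b) := by
      rw [map_smul, map_add]
      module
    have h1 := hα u
    have h2 := hβ.1 u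
    calc ‖L ((2⁻¹ : ℝ) • (α + β)) - b‖
        ≤ ‖(2⁻¹ : ℝ) • (L α - b)‖ + ‖(2⁻¹ : ℝ) • (L β - b)‖ := by
          rw [e]; exact norm_add_le _ _
      _ = 2⁻¹ * ‖L α - b‖ + 2⁻¹ * ‖L β - b‖ := by
          rw [norm_smul, norm_smul]; norm_num
      _ ≤ ‖L u - b‖ := by linarith
  have h3 := hαmin.2 _ hmid
  rw [norm_smul] at h3
  have h4 : 2 * ‖α‖ ≤ ‖α + β‖ := by
    have : ‖(2⁻¹ : ℝ)‖ = 2⁻¹ := by norm_num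
    rw [this] at h3
    linarith
  have h5 := parallelogram_law_with_norm ℝ α β
  have h6 : ‖α - β‖ * ‖α - β‖ ≤ 0 := by
    rw [hnorm] at h5
    nlinarith [norm_nonneg α, norm_nonneg (α + β)]
  have h7 : ‖α - β‖ = 0 := by nlinarith [norm_nonneg (α - β)]
  exact (sub_eq_zero.mp (norm_eq_zero.mp h7)).symm

/-- The minimum-norm estimator
`argmin {‖α‖ : ‖A α - b‖ = min_u ‖A u - b‖}`, which interpolates when `A` has full row rank. -/
def minNormEstimator {n p : ℕ} (A : Matrix (Fin n) (Fin p) ℝ)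
    (b : EuclideanSpace ℝ (Fin n)) : EuclideanSpace ℝ (Fin p) :=
  (existsUnique_isMinNormLeastSquares A b).choose

/-- The estimator computed from the sample `(Xs 0, ys 0), …, (Xs (n-1), ys (n-1))`: the rows of the
data matrix are the observed feature vectors. -/
def sampleEstimator {Ω : Type*} {n p : ℕ} (Xs : Fin n → Ω → EuclideanSpace ℝ (Fin p))
    (ys : Fin n → Ω → ℝ) (ω : Ω) : EuclideanSpace ℝ (Fin p) :=
  minNormEstimator (Matrix.of fun i j => Xs i ω j) (WithLp.toLp 2 fun i => ys i ω)

/-- A real random variable with zero mean, unit variance and sub-Gaussian norm at most `M`. -/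
structure IsStdSubGaussian {Ω : Type*} [MeasurableSpace Ω] (Q : Measure Ω) (M : ℝ)
    (U : Ω → ℝ) : Prop where
  aemeasurable : AEMeasurable U Q
  mean_eq_zero : ∫ ω, U ω ∂Q = 0
  variance_eq_one : Var[U; Q] = 1
  psi2Norm_le : psi2Norm Q U ≤ ENNReal.ofReal M

/-- `X = Σ_X^{1/2} X̃` and `y = σ_y ỹ`, where `Σ_X` is the covariance matrix of `X`,
`σ_y² = E[y²]`, the entries of `X̃` are independent, and the entries of `X̃` as well as `ỹ` are
centred with unit variance and sub-Gaussian norm at most `M`. The dependence between `X̃` and `ỹ`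
is arbitrary. -/
def SubGaussianPair {Ω : Type*} [MeasurableSpace Ω] {p : ℕ} (Q : Measure Ω) (M : ℝ)
    (X : Ω → EuclideanSpace ℝ (Fin p)) (y : Ω → ℝ) : Prop :=
  ∃ (X' : Fin p → Ω → ℝ) (y' : Ω → ℝ),
    iIndepFun X' Q ∧ (∀ j, IsStdSubGaussian Q M (X' j)) ∧ IsStdSubGaussian Q M y' ∧
    (∀ᵐ ω ∂Q, X ω = WithLp.toLp 2 (Matrix.mulVec (CFC.sqrt (covMatrix Q X)) fun j => X' j ω)) ∧
    (∀ᵐ ω ∂Q, y ω = √(∫ ω', y ω' ^ 2 ∂Q) * y' ω)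

/-- `(Xs i, ys i)`, `i < n`, are i.i.d. copies of `(X, y)`. -/
structure IsIIDSample {Ω₀ Ω : Type*} [MeasurableSpace Ω₀] [MeasurableSpace Ω] {n p : ℕ}
    (Q : Measure Ω₀) (X : Ω₀ → EuclideanSpace ℝ (Fin p)) (y : Ω₀ → ℝ) (P : Measure Ω)
    (Xs : Fin n → Ω → EuclideanSpace ℝ (Fin p)) (ys : Fin n → Ω → ℝ) : Prop where
  indep : iIndepFun (fun i ω => (Xs i ω, ys i ω)) P
  identDistrib : ∀ i, IdentDistrib (fun ω => (Xs i ω, ys i ω)) (fun ω => (X ω, y ω)) P Q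

end NullRisk

end

namespace NullRisk

/-! ### Exponential moments of a real law with bounded `ψ₂`-norm -/

/-! For a fixed vector `α`, the mean of `(Xᵀα)²` is `αᵀΣα ≤ ‖Σ‖‖α‖²`. If this is at most `a²σ_y²`,
then expanding the square and weighting the cross term moves the risk by at most `(a² + 2a)σ_y²`,
whatever the dependence between `X` and `y`. It is therefore enough to show that the estimator is
short: with high probability `‖α̂‖²` is at most of order `nσ_y² / tr Σ`, which makes `a` of order
`√(n / r_e)`.

Shortness follows from interpolation. If `‖𝐗ᵀw‖ ≥ s‖w‖` for all `w`, then `𝐗𝐗ᵀ` is invertible, the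
data are interpolated, and `s‖α̂‖ ≤ ‖𝐲‖` (`norm_minNormEstimator_le`). A Chernoff bound gives `‖𝐲‖²
= O(nσ_y²)`, so what remains is a lower bound `s` of order `√(tr Σ)`.

For a unit vector `w`, `‖𝐗ᵀw‖²` is a quadratic form in the `np` independent latent variables, with
matrix `wwᵀ ⊗ Σ`, whose trace is `tr Σ` and whose norm is at most `‖Σ‖`. It lies between fixed
multiples of `tr Σ` outside an event of probability `exp(-c r_e)`. A net of the sphere of `ℝⁿ` has
`exp(O(n))` points, so `r_e > Cn` pays for the union bound, and `mul_norm_le_of_net` passes from the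
net to all `w`.

The exponential moments of the quadratic forms come from `lintegral_exp_quadraticForm_le`, by
induction on the number of variables and without decoupling. Integrating out one variable turns its
linear interaction with the others into a rank-one update of the remaining matrix. The bounds `0 ≤ A
≤ η` survive, and the trace accounts for the cost. A sign `s = ±1` serves both tails. -/

/-- For a centred variable the linear term integrates to zero, so the moment generating function is
controlled by that of the square. -/
theorem exp_le_add_exp_sq (x : ℝ) : Real.exp x ≤ x + Real.exp (x ^ 2) := by
  have h2 := Real.add_one_le_exp (x ^ 2)
  rcases le_or_gt |x| 1 with h | h
  · have h1 := (abs_le.mp (Real.abs_exp_sub_one_sub_id_le h)).2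
    linarith
  · rcases le_or_gt 0 x with h0 | h0
    · rw [abs_of_nonneg h0] at h
      have : Real.exp x ≤ Real.exp (x ^ 2) := Real.exp_le_exp.mpr (by nlinarith)
      linarith
    · rw [abs_of_neg h0] at h
      have : Real.exp x ≤ 1 := Real.exp_le_one_iff.mpr h0.le
      nlinarith

/-- Cauchy–Schwarz in the form of AM-GM, with weights `exp(±(b - a))` that equalize the two bounds.
-/
theorem lintegral_exp_add_le {Ω : Type*} [MeasurableSpace Ω] {μ : Measure Ω} {f g : Ω → ℝ}
    (hf : Measurable f) {a b : ℝ}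
    (ha : ∫⁻ x, ENNReal.ofReal (Real.exp (2 * f x)) ∂μ ≤ ENNReal.ofReal (Real.exp (2 * a)))
    (hb : ∫⁻ x, ENNReal.ofReal (Real.exp (2 * g x)) ∂μ ≤ ENNReal.ofReal (Real.exp (2 * b))) :
    ∫⁻ x, ENNReal.ofReal (Real.exp (f x + g x)) ∂μ ≤ ENNReal.ofReal (Real.exp (a + b)) := by
  have key : ∀ x, ENNReal.ofReal (Real.exp (f x + g x)) ≤
      ENNReal.ofReal (Real.exp (b - a) / 2) * ENNReal.ofReal (Real.exp (2 * f x)) +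
      ENNReal.ofReal (Real.exp (a - b) / 2) * ENNReal.ofReal (Real.exp (2 * g x)) := by
    intro x
    rw [← ENNReal.ofReal_mul (by positivity), ← ENNReal.ofReal_mul (by positivity),
      ← ENNReal.ofReal_add (by positivity) (by positivity)]
    apply ENNReal.ofReal_le_ofReal
    have e1 : Real.exp (b - a) / 2 * Real.exp (2 * f x) =
        Real.exp ((b - a) / 2 + f x) ^ 2 / 2 := by
      rw [← Real.exp_nat_mul, div_mul_eq_mul_div, ← Real.exp_add]; congr 2; push_cast; ring
    have e2 : Real.exp (a - b) / 2 * Real.exp (2 * g x) =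
        Real.exp ((a - b) / 2 + g x) ^ 2 / 2 := by
      rw [← Real.exp_nat_mul, div_mul_eq_mul_div, ← Real.exp_add]; congr 2; push_cast; ring
    have e3 : Real.exp (f x + g x) =
        Real.exp ((b - a) / 2 + f x) * Real.exp ((a - b) / 2 + g x) := by
      rw [← Real.exp_add]; congr 1; ring
    rw [e1, e2, e3]
    nlinarith [sq_nonneg (Real.exp ((b - a) / 2 + f x) - Real.exp ((a - b) / 2 + g x))]
  calc _ ≤ ∫⁻ x, (ENNReal.ofReal (Real.exp (b - a) / 2) * ENNReal.ofReal (Real.exp (2 * f x)) +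
      ENNReal.ofReal (Real.exp (a - b) / 2) * ENNReal.ofReal (Real.exp (2 * g x))) ∂μ :=
        lintegral_mono key
    _ ≤ ENNReal.ofReal (Real.exp (b - a) / 2) * ENNReal.ofReal (Real.exp (2 * a)) +
      ENNReal.ofReal (Real.exp (a - b) / 2) * ENNReal.ofReal (Real.exp (2 * b)) := by
        rw [lintegral_add_left (by fun_prop), lintegral_const_mul' _ _ ENNReal.ofReal_ne_top,
          lintegral_const_mul' _ _ ENNReal.ofReal_ne_top]
        gcongr
    _ = _ := by
        rw [← ENNReal.ofReal_mul (by positivity), ← ENNReal.ofReal_mul (by positivity),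
          ← ENNReal.ofReal_add (by positivity) (by positivity), div_mul_eq_mul_div,
          div_mul_eq_mul_div, ← Real.exp_add, ← Real.exp_add]
        congr 1
        rw [show b - a + 2 * a = a + b by ring, show a - b + 2 * b = a + b by ring]
        ring

section Law

variable {μ : Measure ℝ} {T : ℝ}

theorem integrable_exp_sq
    (h : ∫⁻ x, ENNReal.ofReal (Real.exp (x ^ 2 / T ^ 2)) ∂μ ≤ 2) :
    Integrable (fun x : ℝ => Real.exp (x ^ 2 / T ^ 2)) μ := by
  refine ⟨by fun_prop, ?_⟩
  rw [hasFiniteIntegral_iff_ofReal (ae_of_all _ fun x => by positivity)]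
  exact h.trans_lt (by simp)

theorem integral_exp_sq_le
    (h : ∫⁻ x, ENNReal.ofReal (Real.exp (x ^ 2 / T ^ 2)) ∂μ ≤ 2) :
    ∫ x, Real.exp (x ^ 2 / T ^ 2) ∂μ ≤ 2 := by
  rw [integral_eq_lintegral_of_nonneg_ae (ae_of_all _ fun x => by positivity) (by fun_prop)]
  exact ENNReal.toReal_le_of_le_ofReal (by norm_num) (by simpa using h)

theorem pow_four_le_exp (hT : 0 < T) (x : ℝ) :
    x ^ 4 ≤ 2 * T ^ 4 * Real.exp (x ^ 2 / T ^ 2) := by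
  have h := Real.quadratic_le_exp_of_nonneg (x := x ^ 2 / T ^ 2) (by positivity)
  have h0 : 0 ≤ x ^ 2 / T ^ 2 := by positivity
  have e : x ^ 4 = T ^ 4 * (x ^ 2 / T ^ 2) ^ 2 := by field_simp
  rw [e]
  have : (x ^ 2 / T ^ 2) ^ 2 ≤ 2 * Real.exp (x ^ 2 / T ^ 2) := by linarith
  nlinarith [pow_pos hT 4]

theorem integrable_pow_four (hT : 0 < T)
    (h : ∫⁻ x, ENNReal.ofReal (Real.exp (x ^ 2 / T ^ 2)) ∂μ ≤ 2) :
    Integrable (fun x : ℝ => x ^ 4) μ := by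
  refine ((integrable_exp_sq h).const_mul (2 * T ^ 4)).mono' (by fun_prop) (ae_of_all _ fun x => ?_)
  rw [Real.norm_of_nonneg (by positivity)]
  exact pow_four_le_exp hT x

theorem integral_pow_four_le (hT : 0 < T)
    (h : ∫⁻ x, ENNReal.ofReal (Real.exp (x ^ 2 / T ^ 2)) ∂μ ≤ 2) :
    ∫ x, x ^ 4 ∂μ ≤ 4 * T ^ 4 := by
  calc _ ≤ ∫ x, 2 * T ^ 4 * Real.exp (x ^ 2 / T ^ 2) ∂μ :=
        integral_mono (integrable_pow_four hT h) ((integrable_exp_sq h).const_mul _)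
          fun x => pow_four_le_exp hT x
    _ ≤ _ := by
        rw [integral_const_mul]
        nlinarith [integral_exp_sq_le h, pow_pos hT 4]

variable [IsProbabilityMeasure μ]

/-- By convexity of `exp` on the segment from `0` to `x² / T²`, the integrand is at most `(1 - t) +
t exp(x² / T²)` with `t = aT²`. The integral is then at most `1 + t ≤ exp t`. -/
theorem lintegral_exp_mul_sq_le (hT : 0 < T)
    (h : ∫⁻ x, ENNReal.ofReal (Real.exp (x ^ 2 / T ^ 2)) ∂μ ≤ 2) {a : ℝ} (ha : 0 ≤ a)
    (haT : a * T ^ 2 ≤ 1) :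
    ∫⁻ x, ENNReal.ofReal (Real.exp (a * x ^ 2)) ∂μ ≤ ENNReal.ofReal (Real.exp (a * T ^ 2)) := by
  set t := a * T ^ 2
  have ht : 0 ≤ t := by positivity
  have key : ∀ x : ℝ, ENNReal.ofReal (Real.exp (a * x ^ 2)) ≤
      ENNReal.ofReal (1 - t) + ENNReal.ofReal t * ENNReal.ofReal (Real.exp (x ^ 2 / T ^ 2)) := by
    intro x
    rw [← ENNReal.ofReal_mul ht, ← ENNReal.ofReal_add (by linarith) (by positivity)]
    apply ENNReal.ofReal_le_ofReal
    have := convexOn_exp.2 (Set.mem_univ 0) (Set.mem_univ (x ^ 2 / T ^ 2))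
      (sub_nonneg.mpr haT) ht (by ring)
    simp only [smul_eq_mul, mul_zero, zero_add, Real.exp_zero, mul_one] at this
    rwa [show t * (x ^ 2 / T ^ 2) = a * x ^ 2 by simp only [t]; field_simp] at this
  calc _ ≤ ∫⁻ x, (ENNReal.ofReal (1 - t) +
        ENNReal.ofReal t * ENNReal.ofReal (Real.exp (x ^ 2 / T ^ 2))) ∂μ := lintegral_mono key
    _ ≤ ENNReal.ofReal (1 - t) + ENNReal.ofReal t * 2 := by
        rw [lintegral_add_left (by fun_prop), lintegral_const_mul' _ _ ENNReal.ofReal_ne_top]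
        simp only [lintegral_const, measure_univ, mul_one]
        gcongr
    _ = ENNReal.ofReal (t + 1) := by
        rw [show (2 : ℝ≥0∞) = ENNReal.ofReal 2 by simp, ← ENNReal.ofReal_mul ht,
          ← ENNReal.ofReal_add (by linarith) (by positivity)]
        congr 1; ring
    _ ≤ _ := ENNReal.ofReal_le_ofReal (Real.add_one_le_exp t)

theorem memLp_id_two (hT : 0 < T)
    (h : ∫⁻ x, ENNReal.ofReal (Real.exp (x ^ 2 / T ^ 2)) ∂μ ≤ 2) :
    MemLp (fun x : ℝ => x) 2 μ := by
  rw [memLp_two_iff_integrable_sq (by fun_prop)]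
  refine ((integrable_pow_four hT h).add (integrable_const 1)).mono' (by fun_prop)
    (ae_of_all _ fun x => ?_)
  rw [Real.norm_of_nonneg (by positivity)]
  simp only [Pi.add_apply]
  nlinarith [sq_nonneg (x ^ 2 - 1)]

/-- For small `b` the mean-zero inequality `exp_le_add_exp_sq` reduces to squares. For large `b`,
Young's inequality `bx ≤ b²T²/2 + x²/(2T²)` suffices, because the leftover factor `exp(1/2)` is
absorbed by `exp(b²T²/2)`. -/
theorem lintegral_exp_mul_le (hT : 0 < T)
    (h : ∫⁻ x, ENNReal.ofReal (Real.exp (x ^ 2 / T ^ 2)) ∂μ ≤ 2) (hmean : ∫ x, x ∂μ = 0) (b : ℝ) :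
    ∫⁻ x, ENNReal.ofReal (Real.exp (b * x)) ∂μ ≤ ENNReal.ofReal (Real.exp (b ^ 2 * T ^ 2)) := by
  rcases le_or_gt (b ^ 2 * T ^ 2) 1 with hb | hb
  · have hsq := lintegral_exp_mul_sq_le hT h (sq_nonneg b) hb
    have hint : Integrable (fun x : ℝ => Real.exp (b ^ 2 * x ^ 2)) μ := by
      refine ⟨by fun_prop, ?_⟩
      rw [hasFiniteIntegral_iff_ofReal (ae_of_all _ fun x => by positivity)]
      exact hsq.trans_lt (by simp)
    have hid : Integrable (fun x : ℝ => b * x) μ :=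
      ((memLp_id_two hT h).integrable (by norm_num)).const_mul b
    have hle : ∀ x : ℝ, Real.exp (b * x) ≤ b * x + Real.exp (b ^ 2 * x ^ 2) := fun x => by
      rw [← mul_pow]; exact exp_le_add_exp_sq _
    have hexp : Integrable (fun x : ℝ => Real.exp (b * x)) μ := by
      refine (hid.add hint).mono' (by fun_prop) (ae_of_all _ fun x => ?_)
      rw [Real.norm_of_nonneg (by positivity)]
      exact hle x
    rw [← ofReal_integral_eq_lintegral_ofReal hint (ae_of_all _ fun x => by positivity)] at hsq
    rw [← ofReal_integral_eq_lintegral_ofReal hexp (ae_of_all _ fun x => by positivity)]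
    refine le_trans (ENNReal.ofReal_le_ofReal ?_) hsq
    calc _ ≤ ∫ x, (b * x + Real.exp (b ^ 2 * x ^ 2)) ∂μ :=
          integral_mono hexp (hid.add hint) hle
      _ = _ := by rw [integral_add hid hint, integral_const_mul, hmean]; simp
  · have hsq := lintegral_exp_mul_sq_le hT h (a := 1 / (2 * T ^ 2)) (by positivity)
      (by field_simp; norm_num)
    have key : ∀ x : ℝ, ENNReal.ofReal (Real.exp (b * x)) ≤
        ENNReal.ofReal (Real.exp (b ^ 2 * T ^ 2 / 2)) *
          ENNReal.ofReal (Real.exp (1 / (2 * T ^ 2) * x ^ 2)) := by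
      intro x
      rw [← ENNReal.ofReal_mul (by positivity), ← Real.exp_add]
      apply ENNReal.ofReal_le_ofReal
      apply Real.exp_le_exp.mpr
      have e : b ^ 2 * T ^ 2 / 2 + 1 / (2 * T ^ 2) * x ^ 2 - b * x = (b * T - x / T) ^ 2 / 2 := by
        field_simp; ring
      nlinarith [sq_nonneg (b * T - x / T)]
    refine (lintegral_mono key).trans ?_
    rw [lintegral_const_mul' _ _ ENNReal.ofReal_ne_top]
    calc _ ≤ ENNReal.ofReal (Real.exp (b ^ 2 * T ^ 2 / 2)) *
          ENNReal.ofReal (Real.exp (1 / (2 * T ^ 2) * T ^ 2)) := by gcongr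
      _ ≤ _ := by
        rw [← ENNReal.ofReal_mul (by positivity), ← Real.exp_add]
        apply ENNReal.ofReal_le_ofReal
        apply Real.exp_le_exp.mpr
        have : 1 / (2 * T ^ 2) * T ^ 2 = 1 / 2 := by field_simp
        linarith

/-- The product `(1 + x + x²/2)(1 - x + x²/2)` equals `1 + x⁴/4`. -/
theorem exp_neg_le_quadratic {x : ℝ} (hx : 0 ≤ x) : Real.exp (-x) ≤ 1 - x + x ^ 2 / 2 := by
  have h := Real.quadratic_le_exp_of_nonneg hx
  have hp : 0 < 1 + x + x ^ 2 / 2 := by positivity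
  rw [Real.exp_neg]
  calc (Real.exp x)⁻¹ ≤ (1 + x + x ^ 2 / 2)⁻¹ := inv_anti₀ hp h
    _ ≤ _ := by
      rw [inv_le_iff_one_le_mul₀ hp]
      nlinarith [sq_nonneg (x ^ 2)]

/-- The lower tail needs a genuinely negative first-order term. Unit variance supplies `-a`, and the
fourth moment bound `4T⁴` controls the second-order remainder. -/
theorem lintegral_exp_neg_mul_sq_le (hT : 0 < T)
    (h : ∫⁻ x, ENNReal.ofReal (Real.exp (x ^ 2 / T ^ 2)) ∂μ ≤ 2) (hvar : ∫ x, x ^ 2 ∂μ = 1) {a : ℝ}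
    (ha : 0 ≤ a) :
    ∫⁻ x, ENNReal.ofReal (Real.exp (-(a * x ^ 2))) ∂μ ≤
      ENNReal.ofReal (Real.exp (-a + 2 * T ^ 4 * a ^ 2)) := by
  have h2 : Integrable (fun x : ℝ => x ^ 2) μ := (memLp_id_two hT h).integrable_sq
  have h4 := integrable_pow_four hT h
  have hexp : Integrable (fun x : ℝ => Real.exp (-(a * x ^ 2))) μ := by
    refine (integrable_const (1 : ℝ)).mono' (by fun_prop) (ae_of_all _ fun x => ?_)
    rw [Real.norm_of_nonneg (by positivity), Real.exp_le_one_iff]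
    have : 0 ≤ a * x ^ 2 := by positivity
    linarith
  rw [← ofReal_integral_eq_lintegral_ofReal hexp (ae_of_all _ fun x => by positivity)]
  apply ENNReal.ofReal_le_ofReal
  have hi1 : Integrable (fun x : ℝ => 1 - a * x ^ 2) μ := (integrable_const 1).sub (h2.const_mul a)
  calc _ ≤ ∫ x, ((1 - a * x ^ 2) + a ^ 2 / 2 * x ^ 4) ∂μ := by
        refine integral_mono hexp (hi1.add (h4.const_mul _)) fun x => ?_
        refine (exp_neg_le_quadratic (by positivity)).trans (le_of_eq ?_)
        ring
    _ = 1 - a + a ^ 2 / 2 * ∫ x, x ^ 4 ∂μ := by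
        rw [integral_add hi1 (h4.const_mul _), integral_sub (integrable_const 1) (h2.const_mul a),
          integral_const_mul, integral_const_mul, hvar]
        simp
    _ ≤ (-a + 2 * T ^ 4 * a ^ 2) + 1 := by
        nlinarith [integral_pow_four_le hT h, sq_nonneg a]
    _ ≤ _ := Real.add_one_le_exp _

theorem lintegral_exp_sq_add_linear_le (hT : 0 < T)
    (h : ∫⁻ x, ENNReal.ofReal (Real.exp (x ^ 2 / T ^ 2)) ∂μ ≤ 2) (hmean : ∫ x, x ∂μ = 0) {a : ℝ}
    (ha : 0 ≤ a) (haT : 2 * a * T ^ 2 ≤ 1) (b : ℝ) :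
    ∫⁻ x, ENNReal.ofReal (Real.exp (a * x ^ 2 + b * x)) ∂μ ≤
      ENNReal.ofReal (Real.exp (T ^ 2 * a + 2 * T ^ 2 * b ^ 2)) := by
  refine lintegral_exp_add_le (by fun_prop) ?_ ?_
  · simpa only [mul_assoc, mul_comm, mul_left_comm] using
      lintegral_exp_mul_sq_le hT h (a := 2 * a) (by positivity) haT
  · have := lintegral_exp_mul_le hT h hmean (2 * b)
    rw [show (2 * b) ^ 2 * T ^ 2 = 2 * (2 * T ^ 2 * b ^ 2) by ring] at this
    simpa only [mul_assoc] using this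

theorem lintegral_exp_neg_sq_add_linear_le (hT : 0 < T)
    (h : ∫⁻ x, ENNReal.ofReal (Real.exp (x ^ 2 / T ^ 2)) ∂μ ≤ 2) (hmean : ∫ x, x ∂μ = 0)
    (hvar : ∫ x, x ^ 2 ∂μ = 1) {a : ℝ} (ha : 0 ≤ a) (haT : 16 * a * T ^ 4 ≤ 1) (b : ℝ) :
    ∫⁻ x, ENNReal.ofReal (Real.exp (-(a * x ^ 2) + b * x)) ∂μ ≤
      ENNReal.ofReal (Real.exp (-(3 / 4) * a + 2 * T ^ 2 * b ^ 2)) := by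
  refine lintegral_exp_add_le (by fun_prop) ?_ ?_
  · have := lintegral_exp_neg_mul_sq_le hT h hvar (a := 2 * a) (by positivity)
    simp only [mul_neg, ← mul_assoc]
    refine this.trans (ENNReal.ofReal_le_ofReal (Real.exp_le_exp.mpr ?_))
    nlinarith
  · have := lintegral_exp_mul_le hT h hmean (2 * b)
    rw [show (2 * b) ^ 2 * T ^ 2 = 2 * (2 * T ^ 2 * b ^ 2) by ring] at this
    simpa only [mul_assoc] using this

end Law

/-! ### Exponential moments of quadratic forms in independent variables -/

open Matrix in
theorem dotProduct_mulVec_cons {m : ℕ} {A : Matrix (Fin (m + 1)) (Fin (m + 1)) ℝ} (hA : A.IsSymm)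
    (t : ℝ) (w : Fin m → ℝ) :
    (Fin.cons t w : Fin (m + 1) → ℝ) ⬝ᵥ A *ᵥ (Fin.cons t w : Fin (m + 1) → ℝ) =
      A 0 0 * t ^ 2 + 2 * t * ((fun j => A 0 j.succ) ⬝ᵥ w) +
        w ⬝ᵥ A.submatrix Fin.succ Fin.succ *ᵥ w := by
  have hs : ∀ j : Fin m, A j.succ 0 = A 0 j.succ := fun j => hA.apply 0 j.succ
  simp only [dotProduct, mulVec, Fin.sum_univ_succ, Fin.cons_zero, Fin.cons_succ, hs,
    submatrix_apply, mul_add, Finset.sum_add_distrib, Finset.mul_sum]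
  have e : ∀ j, w j * (A 0 j.succ * t) = t * (A 0 j.succ * w j) := fun j => by ring
  have e' : ∀ j, 2 * t * (A 0 j.succ * w j) =
      t * (A 0 j.succ * w j) + t * (A 0 j.succ * w j) := fun j => by ring
  simp only [e, e', Finset.sum_add_distrib]
  ring

open Matrix in
/-- Integrating out one variable at a time: the symmetric matrix `A`, `0 ≤ A ≤ η`, is replaced by
`A' + 4 s C a aᵀ`, where `A'` and `a` are the remaining block and the off-diagonal part of the first
row of `A`. -/
theorem lintegral_exp_quadraticForm_le {s C η k κ : ℝ} (hs : s = 1 ∨ s = -1) (hC : 0 ≤ C)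
    (hη : 0 < η) (hCη : 8 * C * η ≤ 1) (hk : k ≤ κ) (hk' : k ≤ κ * (1 - 4 * s * C * η)) :
    ∀ {m : ℕ} (μ : Fin m → Measure ℝ) [∀ i, IsProbabilityMeasure (μ i)],
      (∀ i a b, 0 ≤ a → a ≤ η → ∫⁻ x, ENNReal.ofReal (Real.exp (s * (a * x ^ 2) + b * x)) ∂μ i ≤
        ENNReal.ofReal (Real.exp (k * a + C * b ^ 2))) →
      ∀ A : Matrix (Fin m) (Fin m) ℝ, A.IsSymm → (∀ x, 0 ≤ x ⬝ᵥ A *ᵥ x) →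
        (∀ x, x ⬝ᵥ A *ᵥ x ≤ η * (x ⬝ᵥ x)) →
        ∫⁻ x, ENNReal.ofReal (Real.exp (s * (x ⬝ᵥ A *ᵥ x))) ∂Measure.pi μ ≤
          ENNReal.ofReal (Real.exp (κ * A.trace)) := by
  intro m
  induction m with
  | zero =>
    intro μ _ _ A _ _ _
    simp [dotProduct, Matrix.trace]
  | succ m ih =>
    intro μ _ hμ A hA hpos hle
    set a : Fin m → ℝ := fun j => A 0 j.succ with ha
    set A' := A.submatrix Fin.succ Fin.succ with hA'
    have hcons := dotProduct_mulVec_cons hA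
    have hsq : ∀ (t : ℝ) (w : Fin m → ℝ), (Fin.cons t w : Fin (m + 1) → ℝ) ⬝ᵥ Fin.cons t w =
        t ^ 2 + w ⬝ᵥ w := fun t w => by
      simp [dotProduct, Fin.sum_univ_succ]; ring
    have hpos' : ∀ t w, 0 ≤ A 0 0 * t ^ 2 + 2 * t * (a ⬝ᵥ w) + w ⬝ᵥ A' *ᵥ w := fun t w => by
      rw [← hcons]; exact hpos _
    have hle' : ∀ t w, A 0 0 * t ^ 2 + 2 * t * (a ⬝ᵥ w) + w ⬝ᵥ A' *ᵥ w ≤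
        η * (t ^ 2 + w ⬝ᵥ w) := fun t w => by
      rw [← hcons, ← hsq]; exact hle _
    have h00 : 0 ≤ A 0 0 := by simpa using hpos' 1 0
    have h00η : A 0 0 ≤ η := by simpa using hle' 1 0
    -- This is the corner entry of `A² ≤ ηA`. It comes from `ηA(η - A) = (η - A)A(η - A) + A(η -
    -- A)A`: the test vectors are the first columns of `η - A` and of `A`.
    have haa : a ⬝ᵥ a ≤ η * A 0 0 := by
      have h1 := hpos' (η - A 0 0) (-a)
      have h2 := hle' (A 0 0) a
      simp only [dotProduct_neg, neg_dotProduct, mulVec_neg, neg_neg] at h1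
      have : 0 ≤ η * (η * A 0 0 - A 0 0 ^ 2 - a ⬝ᵥ a) := by nlinarith
      have := nonneg_of_mul_nonneg_right this hη
      nlinarith
    have haa0 : 0 ≤ a ⬝ᵥ a := by
      simp only [dotProduct]; exact Finset.sum_nonneg fun i _ => mul_self_nonneg _
    -- Given the other variables `w`, the linear coefficient of the first one is `2s(a·w)`. Its cost
    -- `C(2s(a·w))² = 4C(a·w)²` is the added rank-one form, up to the outer sign `s`.
    set B : Matrix (Fin m) (Fin m) ℝ := A' + (4 * s * C) • vecMulVec a a with hB
    have hBq : ∀ w, w ⬝ᵥ B *ᵥ w = w ⬝ᵥ A' *ᵥ w + 4 * s * C * (a ⬝ᵥ w) ^ 2 := fun w => by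
      rw [hB, add_mulVec, smul_mulVec, dotProduct_add, dotProduct_smul, vecMulVec_mulVec,
        smul_eq_mul, op_smul_eq_smul, dotProduct_smul, smul_eq_mul, dotProduct_comm w a]
      ring
    have hBsymm : B.IsSymm := by
      refine IsSymm.add (hA.submatrix _) (IsSymm.smul ?_ _)
      ext i j; simp [vecMulVec_apply, mul_comm]
    have hBtr : B.trace = A.trace - A 0 0 + 4 * s * C * (a ⬝ᵥ a) := by
      rw [hB, trace_add, trace_smul, trace_vecMulVec, smul_eq_mul]
      congr 1
      simp [Matrix.trace, Fin.sum_univ_succ, hA']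
    -- Only `s = -1` is at risk. Testing `A ≥ 0` with first coordinate `-4C(a·w)` and using `CA₀₀ ≤
    -- 1/8` leaves `wᵀA'w ≥ 6C(a·w)²`, more than the `4C(a·w)²` subtracted.
    have hBpos : ∀ w, 0 ≤ w ⬝ᵥ B *ᵥ w := fun w => by
      rw [hBq]
      have h0 := hpos' 0 w
      have h1 := hpos' (-(4 * C * (a ⬝ᵥ w))) w
      rcases hs with rfl | rfl
      · have : 0 ≤ 4 * 1 * C * (a ⬝ᵥ w) ^ 2 := by positivity
        simp only [ne_eq, OfNat.ofNat_ne_zero, not_false_eq_true, zero_pow, mul_zero, zero_mul,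
          add_zero, zero_add] at h0
        linarith
      · have h2 : C * A 0 0 ≤ 1 / 8 := by nlinarith
        have h3 : 0 ≤ C * (a ⬝ᵥ w) ^ 2 := by positivity
        nlinarith
    -- Here `s = 1` is the delicate case. The test vector with first coordinate `4C(a·w)` yields
    -- room `6C(a·w)²` for the added `4C(a·w)²`.
    have hBle : ∀ w, w ⬝ᵥ B *ᵥ w ≤ η * (w ⬝ᵥ w) := fun w => by
      rw [hBq]
      have h0 := hle' 0 w
      have h1 := hle' (4 * C * (a ⬝ᵥ w)) w
      rcases hs with rfl | rfl
      · have h3 : 0 ≤ C * (a ⬝ᵥ w) ^ 2 := by positivity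
        have h4 : 0 ≤ A 0 0 * (4 * C * (a ⬝ᵥ w)) ^ 2 := by positivity
        have h5 : 8 * C * η * (C * (a ⬝ᵥ w) ^ 2) ≤ 1 * (C * (a ⬝ᵥ w) ^ 2) := by gcongr
        nlinarith
      · have : 0 ≤ 4 * C * (a ⬝ᵥ w) ^ 2 := by positivity
        simp only [ne_eq, OfNat.ofNat_ne_zero, not_false_eq_true, zero_pow, mul_zero, zero_mul,
          add_zero, zero_add] at h0
        linarith
    have hinner : ∀ w : Fin m → ℝ, ∫⁻ t, ENNReal.ofReal (Real.exp
          (s * ((Fin.cons t w : Fin (m + 1) → ℝ) ⬝ᵥ A *ᵥ (Fin.cons t w : Fin (m + 1) → ℝ)))) ∂μ 0 ≤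
        ENNReal.ofReal (Real.exp (k * A 0 0)) *
          ENNReal.ofReal (Real.exp (s * (w ⬝ᵥ B *ᵥ w))) := fun w => by
      have h := hμ 0 (A 0 0) (2 * s * (a ⬝ᵥ w)) h00 h00η
      calc _ = ∫⁻ t, ENNReal.ofReal (Real.exp (s * (w ⬝ᵥ A' *ᵥ w))) * ENNReal.ofReal
            (Real.exp (s * (A 0 0 * t ^ 2) + 2 * s * (a ⬝ᵥ w) * t)) ∂μ 0 := by
            refine lintegral_congr fun t => ?_
            rw [← ENNReal.ofReal_mul (by positivity), ← Real.exp_add, hcons]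
            congr 2; ring
        _ ≤ ENNReal.ofReal (Real.exp (s * (w ⬝ᵥ A' *ᵥ w))) * ENNReal.ofReal
            (Real.exp (k * A 0 0 + C * (2 * s * (a ⬝ᵥ w)) ^ 2)) := by
            rw [lintegral_const_mul' _ _ ENNReal.ofReal_ne_top]
            gcongr
        _ = _ := by
            rw [← ENNReal.ofReal_mul (by positivity), ← ENNReal.ofReal_mul (by positivity),
              ← Real.exp_add, ← Real.exp_add, hBq]
            congr 2
            ring
    have hmp := (measurePreserving_piFinSuccAbove μ 0).symm
    rw [← hmp.lintegral_comp_emb (MeasurableEquiv.measurableEmbedding _)]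
    have hmeas : Measurable fun x : Fin (m + 1) → ℝ =>
        ENNReal.ofReal (Real.exp (s * (x ⬝ᵥ A *ᵥ x))) := by
      simp only [dotProduct, mulVec]; fun_prop
    refine (lintegral_prod_symm' _ (hmeas.comp (MeasurableEquiv.measurable _))).trans_le ?_
    calc _ ≤ ∫⁻ w, ENNReal.ofReal (Real.exp (k * A 0 0)) *
          ENNReal.ofReal (Real.exp (s * (w ⬝ᵥ B *ᵥ w))) ∂Measure.pi fun j : Fin m => μ j.succ := by
          refine lintegral_mono fun w => ?_
          simpa [MeasurableEquiv.piFinSuccAbove, Fin.insertNthEquiv] using hinner w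
      _ ≤ ENNReal.ofReal (Real.exp (k * A 0 0)) * ENNReal.ofReal (Real.exp (κ * B.trace)) := by
          rw [lintegral_const_mul' _ _ ENNReal.ofReal_ne_top]
          gcongr
          exact ih _ (fun i => hμ i.succ) B hBsymm hBpos hBle
      _ ≤ _ := by
          rw [← ENNReal.ofReal_mul (by positivity), ← Real.exp_add]
          apply ENNReal.ofReal_le_ofReal
          apply Real.exp_le_exp.mpr
          rw [hBtr]
          -- The required inequality is affine in `a ⬝ᵥ a`, which ranges over `[0, ηA₀₀]`. The
          -- hypotheses `hk` and `hk'` are its two endpoint cases, and these products interpolate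
          -- between them.
          have h1 : 0 ≤ (η * A 0 0 - a ⬝ᵥ a) * (κ - k) :=
            mul_nonneg (by linarith) (by linarith)
          have h2 : 0 ≤ (a ⬝ᵥ a) * (κ * (1 - 4 * s * C * η) - k) :=
            mul_nonneg haa0 (by linarith)
          have h3 : 0 ≤ η * (κ * A 0 0 - k * A 0 0 - κ * (4 * s * C * (a ⬝ᵥ a))) := by
            nlinarith
          have := nonneg_of_mul_nonneg_right h3 hη
          linarith

open Matrix in
/-- The same bound for a finite family of independent random variables. -/
theorem lintegral_exp_quadraticForm_le_of_iIndepFun {ι Ω : Type*} [Fintype ι]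
    [MeasurableSpace Ω] {P : Measure Ω} [IsProbabilityMeasure P] {Z : ι → Ω → ℝ}
    (hZ : iIndepFun Z P) (hZm : ∀ i, Measurable (Z i))
    {s C η k κ : ℝ} (hs : s = 1 ∨ s = -1) (hC : 0 ≤ C)
    (hη : 0 < η) (hCη : 8 * C * η ≤ 1) (hk : k ≤ κ) (hk' : k ≤ κ * (1 - 4 * s * C * η))
    (hμ : ∀ i a b, 0 ≤ a → a ≤ η →
      ∫⁻ x, ENNReal.ofReal (Real.exp (s * (a * x ^ 2) + b * x)) ∂(P.map (Z i)) ≤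
        ENNReal.ofReal (Real.exp (k * a + C * b ^ 2)))
    {A : Matrix ι ι ℝ} (hA : A.IsSymm) (hpos : ∀ x, 0 ≤ x ⬝ᵥ A *ᵥ x)
    (hle : ∀ x, x ⬝ᵥ A *ᵥ x ≤ η * (x ⬝ᵥ x)) :
    ∫⁻ ω, ENNReal.ofReal (Real.exp (s * ((fun i => Z i ω) ⬝ᵥ A *ᵥ fun i => Z i ω))) ∂P ≤
      ENNReal.ofReal (Real.exp (κ * A.trace)) := by
  let e := (Fintype.equivFin ι).symm
  have hZe : iIndepFun (fun i => Z (e i)) P := hZ.precomp e.injective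
  have hmap := (iIndepFun_iff_map_fun_eq_pi_map fun i => (hZm (e i)).aemeasurable).mp hZe
  have hprob : ∀ i, IsProbabilityMeasure (P.map (Z (e i))) := fun i =>
    Measure.isProbabilityMeasure_map (hZm _).aemeasurable
  have hq : ∀ x : ι → ℝ, (x ∘ e) ⬝ᵥ A.submatrix e e *ᵥ (x ∘ e) = x ⬝ᵥ A *ᵥ x := fun x => by
    rw [submatrix_mulVec_equiv, comp_equiv_dotProduct_comp_equiv, Function.comp_assoc,
      Equiv.self_comp_symm, Function.comp_id]
  have hx : ∀ x : Fin (Fintype.card ι) → ℝ, x = (x ∘ e.symm) ∘ e := fun x => by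
    rw [Function.comp_assoc, Equiv.symm_comp_self, Function.comp_id]
  have key := lintegral_exp_quadraticForm_le hs hC hη hCη hk hk' (fun i => P.map (Z (e i)))
    (fun i => hμ (e i)) (A.submatrix e e) (hA.submatrix _)
    (fun x => by rw [hx x, hq]; exact hpos _)
    (fun x => by rw [hx x, hq, comp_equiv_dotProduct_comp_equiv]; exact hle _)
  rw [← hmap, lintegral_map (by simp only [dotProduct, mulVec]; fun_prop) (by fun_prop),
    show (A.submatrix e e).trace = A.trace from Equiv.sum_comp e fun i => A i i] at key
  refine le_trans (le_of_eq (lintegral_congr fun ω => ?_)) key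
  rw [← hq]; rfl

/-! ### Nets of the unit sphere -/

section Net

variable {E : Type*} [NormedAddCommGroup E] [NormedSpace ℝ E]

/-- Two-sided control of a linear map on a fine net of the sphere gives a lower bound everywhere. -/
theorem mul_norm_le_of_net {F : Type*} [NormedAddCommGroup F] [NormedSpace ℝ F]
    (L : E →L[ℝ] F) {s : Set E} {ε a b : ℝ} (ha : 0 ≤ a) (hε : ε ≤ 1 / 2)
    (hnet : ∀ x : E, ‖x‖ = 1 → ∃ c ∈ s, ‖x - c‖ ≤ ε) (hup : ∀ c ∈ s, ‖L c‖ ≤ a)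
    (hlow : ∀ c ∈ s, b ≤ ‖L c‖) (x : E) : (b - 2 * a * ε) * ‖x‖ ≤ ‖L x‖ := by
  have scale : ∀ x : E, x ≠ 0 → ‖(‖x‖⁻¹ • x)‖ = 1 ∧ ‖L x‖ = ‖x‖ * ‖L (‖x‖⁻¹ • x)‖ := by
    intro x hx
    have : ‖x‖ ≠ 0 := norm_ne_zero_iff.mpr hx
    rw [map_smul, norm_smul, norm_smul, norm_inv, norm_norm]
    constructor <;> field_simp
  -- A self-bounding estimate: finiteness of `‖L‖` turns it into `‖L‖ ≤ 2a`, the source of the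
  -- factor `2a` in the conclusion.
  have hL : ‖L‖ ≤ a + ‖L‖ / 2 := by
    refine L.opNorm_le_bound (by positivity) fun x => ?_
    rcases eq_or_ne x 0 with rfl | hx
    · simp
    obtain ⟨h1, h2⟩ := scale x hx
    obtain ⟨c, hc, hxc⟩ := hnet _ h1
    rw [h2, mul_comm]
    gcongr
    calc ‖L (‖x‖⁻¹ • x)‖ = ‖L c + L (‖x‖⁻¹ • x - c)‖ := by rw [← map_add]; simp
      _ ≤ ‖L c‖ + ‖L‖ * ‖‖x‖⁻¹ • x - c‖ := (norm_add_le _ _).trans (by gcongr; exact L.le_opNorm _)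
      _ ≤ a + ‖L‖ * (1 / 2) := by gcongr; exacts [hup c hc, hxc.trans hε]
      _ = _ := by ring
  rcases eq_or_ne x 0 with rfl | hx
  · simp
  obtain ⟨h1, h2⟩ := scale x hx
  obtain ⟨c, hc, hxc⟩ := hnet _ h1
  rw [h2, mul_comm]
  gcongr
  have h3 : ‖L c‖ ≤ ‖L (‖x‖⁻¹ • x)‖ + ‖L‖ * ‖‖x‖⁻¹ • x - c‖ := by
    calc ‖L c‖ = ‖L (‖x‖⁻¹ • x) - L (‖x‖⁻¹ • x - c)‖ := by rw [← map_sub]; simp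
      _ ≤ _ := (norm_sub_le _ _).trans (by gcongr; exact L.le_opNorm _)
  have h4 : ‖L‖ * ‖‖x‖⁻¹ • x - c‖ ≤ (2 * a) * ε := by
    gcongr
    linarith
  linarith [hlow c hc]

variable [FiniteDimensional ℝ E]

open Metric Module in
-- Volume comparison: the balls of radius `ε/2` about the points are disjoint and lie in the ball of
-- radius `1 + ε/2`.
theorem card_le_of_separated_of_norm_le_one {ε : ℝ} (hε : 0 < ε) (s : Finset E)
    (hs : ∀ c ∈ s, ‖c‖ ≤ 1) (h : ∀ c ∈ s, ∀ d ∈ s, c ≠ d → ε ≤ ‖c - d‖) :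
    (s.card : ℝ) ≤ (1 + 2 / ε) ^ finrank ℝ E := by
  borelize E
  let μ : Measure E := Measure.addHaar
  have hδ : 0 < ε / 2 := by positivity
  have hρ : 0 < 1 + ε / 2 := by positivity
  have D : Set.Pairwise (s : Set E) (Function.onFun Disjoint fun c => ball (c : E) (ε / 2)) := by
    rintro c hc d hd hcd
    apply ball_disjoint_ball
    rw [dist_eq_norm]
    linarith [h c hc d hd hcd]
  have hsub : ⋃ c ∈ s, ball (c : E) (ε / 2) ⊆ ball (0 : E) (1 + ε / 2) := by
    refine Set.iUnion₂_subset fun x hx => ball_subset_ball' ?_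
    rw [dist_zero_right]
    linarith [hs x hx]
  have I : (s.card : ℝ≥0∞) * ENNReal.ofReal ((ε / 2) ^ finrank ℝ E) * μ (ball 0 1) ≤
      ENNReal.ofReal ((1 + ε / 2) ^ finrank ℝ E) * μ (ball 0 1) :=
    calc _ = μ (⋃ c ∈ s, ball (c : E) (ε / 2)) := by
          rw [measure_biUnion_finset D fun c _ => measurableSet_ball]
          simp only [μ.addHaar_ball_of_pos _ hδ, Finset.sum_const, nsmul_eq_mul, mul_assoc]
      _ ≤ μ (ball (0 : E) (1 + ε / 2)) := measure_mono hsub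
      _ = _ := μ.addHaar_ball_of_pos _ hρ
  have J : (s.card : ℝ≥0∞) * ENNReal.ofReal ((ε / 2) ^ finrank ℝ E) ≤
      ENNReal.ofReal ((1 + ε / 2) ^ finrank ℝ E) :=
    (ENNReal.mul_le_mul_iff_left (measure_ball_pos _ _ zero_lt_one).ne' measure_ball_lt_top.ne).1 I
  have K := ENNReal.toReal_le_of_le_ofReal (by positivity) J
  rw [ENNReal.toReal_mul, ENNReal.toReal_natCast, ENNReal.toReal_ofReal (by positivity),
    ← le_div_iff₀ (by positivity), ← div_pow] at K
  refine K.trans (le_of_eq ?_)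
  congr 1
  field_simp
  ring

/-- If no separated set within the cardinality bound were a net, each could be enlarged by a point
far from it, giving separated sets of every size, against the volume bound. -/
theorem exists_finset_sphere_net {ε : ℝ} (hε : 0 < ε) :
    ∃ s : Finset E, (∀ c ∈ s, ‖c‖ = 1) ∧ (s.card : ℝ) ≤ (1 + 2 / ε) ^ Module.finrank ℝ E ∧
      ∀ x : E, ‖x‖ = 1 → ∃ c ∈ s, ‖x - c‖ ≤ ε := by
  classical
  by_contra! hcon
  have key : ∀ k : ℕ, ∃ s : Finset E, s.card = k ∧ (∀ c ∈ s, ‖c‖ = 1) ∧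
      ∀ c ∈ s, ∀ d ∈ s, c ≠ d → ε ≤ ‖c - d‖ := by
    intro k
    induction k with
    | zero => exact ⟨∅, by simp⟩
    | succ k ih =>
      obtain ⟨s, hk, hs, hsep⟩ := ih
      obtain ⟨x, hx, hxs⟩ := hcon s hs
        (card_le_of_separated_of_norm_le_one hε s (fun c hc => (hs c hc).le) hsep)
      have hxn : x ∉ s := fun hmem => by
        have := hxs x hmem
        rw [sub_self, norm_zero] at this
        linarith
      refine ⟨insert x s, by rw [Finset.card_insert_of_notMem hxn, hk], ?_, ?_⟩
      · simpa [hx] using hs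
      · intro c hc d hd hcd
        rcases Finset.mem_insert.mp hc with rfl | hcs
        · rcases Finset.mem_insert.mp hd with rfl | hds
          · exact absurd rfl hcd
          · exact (hxs d hds).le
        · rcases Finset.mem_insert.mp hd with rfl | hds
          · rw [norm_sub_rev]; exact (hxs c hcs).le
          · exact hsep c hcs d hds hcd
  obtain ⟨k, hk⟩ := exists_nat_gt ((1 + 2 / ε) ^ Module.finrank ℝ E)
  obtain ⟨s, hsk, hs, hsep⟩ := key k
  have := card_le_of_separated_of_norm_le_one hε s (fun c hc => (hs c hc).le) hsep
  rw [hsk] at this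
  linarith

end Net

/-! ### The minimum-norm least-squares estimator -/

open Matrix in
-- The lower bound makes `AAᵀ` injective, hence surjective, so `α = Aᵀw` with `AAᵀw = b`
-- interpolates and competes with the estimator. Moreover `‖α‖² = ⟨w, b⟩ ≤ ‖w‖‖b‖` and `s‖w‖ ≤ ‖α‖`.
theorem norm_minNormEstimator_le {n p : ℕ} (A : Matrix (Fin n) (Fin p) ℝ)
    (b : EuclideanSpace ℝ (Fin n)) {s : ℝ} (hs : 0 < s)
    (h : ∀ x : EuclideanSpace ℝ (Fin n), s * ‖x‖ ≤ ‖toEuclideanLin Aᵀ x‖) :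
    s * ‖minNormEstimator A b‖ ≤ ‖b‖ := by
  set L := toEuclideanLin A with hL
  have hadj : ∀ x y, inner ℝ (toEuclideanLin Aᵀ x) y = inner ℝ x (L y) := fun x y => by
    rw [← conjTranspose_eq_transpose_of_trivial, toEuclideanLin_conjTranspose_eq_adjoint,
      LinearMap.adjoint_inner_left]
  have hinj : Function.Injective (L ∘ₗ toEuclideanLin Aᵀ) := by
    rw [injective_iff_map_eq_zero]
    intro x hx
    have h0 : ‖toEuclideanLin Aᵀ x‖ ^ 2 = 0 := by
      rw [← real_inner_self_eq_norm_sq, hadj]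
      rw [LinearMap.comp_apply] at hx
      rw [hx, inner_zero_right]
    have h1 := h x
    rw [pow_eq_zero_iff two_ne_zero] at h0
    rw [h0] at h1
    exact norm_le_zero_iff.mp (nonpos_of_mul_nonpos_right h1 hs)
  obtain ⟨w, hw⟩ := (LinearMap.injective_iff_surjective.mp hinj) b
  set α := toEuclideanLin Aᵀ w
  have hα : L α = b := hw
  have hle : ‖minNormEstimator A b‖ ≤ ‖α‖ := by
    refine (existsUnique_isMinNormLeastSquares A b).choose_spec.1.2 α fun u => ?_
    rw [← hL, hα, sub_self, norm_zero]
    exact norm_nonneg _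
  have h1 : ‖α‖ ^ 2 ≤ ‖w‖ * ‖b‖ := by
    rw [← real_inner_self_eq_norm_sq, hadj, hα]
    exact real_inner_le_norm _ _
  have h2 : s * ‖α‖ ≤ ‖b‖ := by
    rcases (norm_nonneg α).eq_or_lt with h0 | h0
    · rw [← h0]; simp
    · have h3 : s * ‖α‖ * ‖α‖ ≤ ‖b‖ * ‖α‖ := by
        calc s * ‖α‖ * ‖α‖ = s * ‖α‖ ^ 2 := by ring
          _ ≤ s * (‖w‖ * ‖b‖) := by gcongr
          _ = s * ‖w‖ * ‖b‖ := by ring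
          _ ≤ ‖α‖ * ‖b‖ := by gcongr; exact h w
          _ = _ := by ring
      exact le_of_mul_le_mul_right h3 h0
  exact (by gcongr : s * ‖minNormEstimator A b‖ ≤ s * ‖α‖).trans h2

/-! ### Consequences of the moment assumptions -/

section Moments

variable {Ω : Type*} [MeasurableSpace Ω] {Q : Measure Ω} {M : ℝ} {U : Ω → ℝ}

/-- Doubling `M` avoids the question whether the infimum is attained: some admissible `t` lies
strictly below `2M`. -/
theorem IsStdSubGaussian.lintegral_exp_sq_le (hU : IsStdSubGaussian Q M U) (hM : 0 < M) :
    ∫⁻ ω, ENNReal.ofReal (Real.exp (U ω ^ 2 / (2 * M) ^ 2)) ∂Q ≤ 2 := by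
  have hlt : psi2Norm Q U < ENNReal.ofReal (2 * M) :=
    hU.psi2Norm_le.trans_lt ((ENNReal.ofReal_lt_ofReal_iff (by positivity)).mpr (by linarith))
  obtain ⟨_, ⟨t, ht, hint, rfl⟩, hlt⟩ := sInf_lt_iff.mp hlt
  have htM : t < 2 * M := (ENNReal.ofReal_lt_ofReal_iff (by positivity)).mp hlt
  refine le_trans (lintegral_mono fun ω => ?_) hint
  gcongr

theorem IsStdSubGaussian.lintegral_map_exp_sq_le (hU : IsStdSubGaussian Q M U) (hM : 0 < M) :
    ∫⁻ x, ENNReal.ofReal (Real.exp (x ^ 2 / (2 * M) ^ 2)) ∂(Q.map U) ≤ 2 := by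
  rw [lintegral_map' (by fun_prop) hU.aemeasurable]
  exact hU.lintegral_exp_sq_le hM

theorem IsStdSubGaussian.integral_map_eq_zero (hU : IsStdSubGaussian Q M U) :
    ∫ x, x ∂(Q.map U) = 0 := by
  rw [integral_map hU.aemeasurable (by fun_prop), hU.mean_eq_zero]

theorem IsStdSubGaussian.integral_map_sq (hU : IsStdSubGaussian Q M U) :
    ∫ x, x ^ 2 ∂(Q.map U) = 1 := by
  rw [integral_map hU.aemeasurable (by fun_prop), ← hU.variance_eq_one,
    variance_of_integral_eq_zero hU.aemeasurable hU.mean_eq_zero]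

theorem IsStdSubGaussian.memLp_two [IsProbabilityMeasure Q] (hU : IsStdSubGaussian Q M U)
    (hM : 0 < M) : MemLp U 2 Q := by
  have := Measure.isProbabilityMeasure_map hU.aemeasurable (μ := Q)
  have h := memLp_id_two (by positivity) (hU.lintegral_map_exp_sq_le hM)
  exact (memLp_map_measure_iff (by fun_prop) hU.aemeasurable).mp h

end Moments

open Matrix in
theorem dotProduct_mulVec_le_norm {p : ℕ} (S : Matrix (Fin p) (Fin p) ℝ) (x : Fin p → ℝ) :
    x ⬝ᵥ S *ᵥ x ≤ ‖toEuclideanCLM (𝕜 := ℝ) S‖ * (x ⬝ᵥ x) := by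
  have h : x ⬝ᵥ S *ᵥ x = inner ℝ (WithLp.toLp 2 x) (toEuclideanCLM (𝕜 := ℝ) S (WithLp.toLp 2 x)) := by
    rw [toEuclideanCLM_toLp, EuclideanSpace.inner_toLp_toLp, star_trivial, dotProduct_comm]
  have h' : x ⬝ᵥ x = ‖WithLp.toLp 2 x‖ ^ 2 := by
    rw [← real_inner_self_eq_norm_sq, EuclideanSpace.inner_toLp_toLp, star_trivial]
  rw [h, h']
  calc _ ≤ _ := real_inner_le_norm _ _
    _ ≤ ‖WithLp.toLp 2 x‖ * (‖toEuclideanCLM (𝕜 := ℝ) S‖ * ‖WithLp.toLp 2 x‖) := by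
        gcongr; exact ContinuousLinearMap.le_opNorm _ _
    _ = _ := by ring

/-! ### Second moments of the feature vector and its covariance matrix -/

section Covariance

variable {Ω : Type*} [MeasurableSpace Ω] {Q : Measure Ω} [IsProbabilityMeasure Q] {M : ℝ} {p : ℕ}
  {X : Ω → EuclideanSpace ℝ (Fin p)} {X' : Fin p → Ω → ℝ} {B : Matrix (Fin p) (Fin p) ℝ}

theorem memLp_coord (hM : 0 < M) (hX' : ∀ j, IsStdSubGaussian Q M (X' j))
    (hX : ∀ᵐ ω ∂Q, X ω = WithLp.toLp 2 (Matrix.mulVec B fun j => X' j ω)) (i : Fin p) :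
    MemLp (fun ω => X ω i) 2 Q := by
  have h : MemLp (fun ω => ∑ j, B i j * X' j ω) 2 Q :=
    memLp_finsetSum _ fun j _ => ((hX' j).memLp_two hM).const_mul _
  refine h.ae_eq ?_
  filter_upwards [hX] with ω hω
  rw [hω]; rfl

theorem integral_coord_eq_zero (hM : 0 < M) (hX' : ∀ j, IsStdSubGaussian Q M (X' j))
    (hX : ∀ᵐ ω ∂Q, X ω = WithLp.toLp 2 (Matrix.mulVec B fun j => X' j ω)) (i : Fin p) :
    ∫ ω, X ω i ∂Q = 0 := by
  have h : (fun ω => X ω i) =ᵐ[Q] fun ω => ∑ j, B i j * X' j ω := by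
    filter_upwards [hX] with ω hω
    rw [hω]; rfl
  rw [integral_congr_ae h, integral_finsetSum _ fun j _ =>
    (((hX' j).memLp_two hM).integrable (by norm_num)).const_mul _]
  simp [integral_const_mul, (hX' _).mean_eq_zero]

open Matrix in
-- The coordinates of `X` are centred, so the covariances are plain second moments.
theorem integral_inner_sq (hM : 0 < M) (hX' : ∀ j, IsStdSubGaussian Q M (X' j))
    (hX : ∀ᵐ ω ∂Q, X ω = WithLp.toLp 2 (Matrix.mulVec B fun j => X' j ω))
    (α : EuclideanSpace ℝ (Fin p)) :
    ∫ ω, (inner ℝ (X ω) α) ^ 2 ∂Q = α.ofLp ⬝ᵥ covMatrix Q X *ᵥ α.ofLp := by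
  have hL := memLp_coord hM hX' hX
  have hcov : ∀ i j, covMatrix Q X i j = ∫ ω, X ω i * X ω j ∂Q := fun i j => by
    simp only [covMatrix, Matrix.of_apply]
    rw [covariance_eq_sub (hL i) (hL j), integral_coord_eq_zero hM hX' hX i]
    simp
  have hint : ∀ i j, Integrable (fun ω => α i * α j * (X ω i * X ω j)) Q := fun i j =>
    ((hL i).integrable_mul (hL j)).const_mul _
  have hexp : ∀ ω, (inner ℝ (X ω) α) ^ 2 = ∑ i, ∑ j, α i * α j * (X ω i * X ω j) := fun ω => by
    rw [PiLp.inner_apply, sq, Finset.sum_mul_sum]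
    refine Finset.sum_congr rfl fun i _ => Finset.sum_congr rfl fun j _ => ?_
    simp only [RCLike.inner_apply, conj_trivial]
    ring
  simp only [hexp]
  rw [integral_finsetSum _ fun i _ => integrable_finsetSum _ fun j _ => hint i j]
  simp only [dotProduct, mulVec, Finset.mul_sum]
  refine Finset.sum_congr rfl fun i _ => ?_
  rw [integral_finsetSum _ fun j _ => hint i j]
  refine Finset.sum_congr rfl fun j _ => ?_
  rw [integral_const_mul, hcov]
  ring

open Matrix in
theorem posSemidef_covMatrix (hM : 0 < M) (hX' : ∀ j, IsStdSubGaussian Q M (X' j))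
    (hX : ∀ᵐ ω ∂Q, X ω = WithLp.toLp 2 (Matrix.mulVec B fun j => X' j ω)) :
    (covMatrix Q X).PosSemidef := by
  refine PosSemidef.of_dotProduct_mulVec_nonneg ?_ fun x => ?_
  · ext i j
    simp [covMatrix, covariance_comm]
  · rw [star_trivial]
    have := integral_inner_sq hM hX' hX (WithLp.toLp 2 x)
    simp only at this
    rw [← this]
    exact integral_nonneg fun ω => sq_nonneg _

end Covariance

/-! ### The risk of a short weight vector -/

/-- Pointwise `|f² - 2fg| ≤ (1 + 1/a)f² + ag²`. The weight `a` balances the two parts of the cross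
term after integration. -/
theorem abs_integral_sub_sq_sub_le {Ω : Type*} [MeasurableSpace Ω] {Q : Measure Ω} {f g : Ω → ℝ}
    (hf : MemLp f 2 Q) (hg : MemLp g 2 Q) {a : ℝ} (ha : 0 < a)
    (h : ∫ ω, f ω ^ 2 ∂Q ≤ a ^ 2 * ∫ ω, g ω ^ 2 ∂Q) :
    |∫ ω, (f ω - g ω) ^ 2 ∂Q - ∫ ω, g ω ^ 2 ∂Q| ≤ (a ^ 2 + 2 * a) * ∫ ω, g ω ^ 2 ∂Q := by
  have hf2 := hf.integrable_sq
  have hg2 := hg.integrable_sq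
  have hfg2 : Integrable (fun ω => (f ω - g ω) ^ 2) Q := (hf.sub hg).integrable_sq
  rw [← integral_sub hfg2 hg2]
  calc |∫ ω, ((f ω - g ω) ^ 2 - g ω ^ 2) ∂Q|
      ≤ ∫ ω, |(f ω - g ω) ^ 2 - g ω ^ 2| ∂Q := abs_integral_le_integral_abs
    _ ≤ ∫ ω, ((1 + 1 / a) * f ω ^ 2 + a * g ω ^ 2) ∂Q := by
        refine integral_mono (hfg2.sub hg2).abs ((hf2.const_mul _).add (hg2.const_mul _))
          fun ω => ?_
        have e : (1 + 1 / a) * f ω ^ 2 + a * g ω ^ 2 =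
            f ω ^ 2 + ((f ω / a) ^ 2 + g ω ^ 2) * a := by field_simp; ring
        have e' : f ω = (f ω / a) * a := by field_simp
        set u := f ω / a
        have h1 := mul_nonneg (sq_nonneg (u - g ω)) ha.le
        have h2 := mul_nonneg (sq_nonneg (u + g ω)) ha.le
        show |(f ω - g ω) ^ 2 - g ω ^ 2| ≤ _
        rw [e, abs_le]
        have e3 : f ω * g ω = u * a * g ω := by rw [← e']
        constructor <;> nlinarith [sq_nonneg (f ω)]
    _ = (1 + 1 / a) * ∫ ω, f ω ^ 2 ∂Q + a * ∫ ω, g ω ^ 2 ∂Q := by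
        rw [integral_add (hf2.const_mul _) (hg2.const_mul _), integral_const_mul,
          integral_const_mul]
    _ ≤ (1 + 1 / a) * (a ^ 2 * ∫ ω, g ω ^ 2 ∂Q) + a * ∫ ω, g ω ^ 2 ∂Q := by gcongr
    _ = _ := by field_simp; ring

theorem SubGaussianPair.abs_risk_div_sub_one_le {Ω : Type*} [MeasurableSpace Ω] {Q : Measure Ω}
    [IsProbabilityMeasure Q] {M : ℝ} (hM : 0 < M) {p : ℕ} {X : Ω → EuclideanSpace ℝ (Fin p)}
    {y : Ω → ℝ} (h : SubGaussianPair Q M X y) (hy : 0 < ∫ ω, y ω ^ 2 ∂Q)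
    {α : EuclideanSpace ℝ (Fin p)} {a : ℝ} (ha : 0 < a)
    (hα : ‖Matrix.toEuclideanCLM (𝕜 := ℝ) (covMatrix Q X)‖ * ‖α‖ ^ 2 ≤ a ^ 2 * ∫ ω, y ω ^ 2 ∂Q) :
    |risk Q X y α / risk Q X y 0 - 1| ≤ a ^ 2 + 2 * a := by
  obtain ⟨X', y', -, hX', hy', hX, hyy'⟩ := h
  have hyL : MemLp y 2 Q :=
    ((hy'.memLp_two hM).const_mul (√(∫ ω', y ω' ^ 2 ∂Q))).ae_eq (hyy'.mono fun ω h => h.symm)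
  have hXL : MemLp (fun ω => inner ℝ (X ω) α) 2 Q := by
    have : ∀ ω, inner ℝ (X ω) α = ∑ i, α i * X ω i := fun ω => by
      rw [PiLp.inner_apply]; simp
    simp only [this]
    exact memLp_finsetSum _ fun i _ => (memLp_coord hM hX' hX i).const_mul _
  have h0 : risk Q X y 0 = ∫ ω, y ω ^ 2 ∂Q := by simp [risk]
  have hle : ∫ ω, (inner ℝ (X ω) α) ^ 2 ∂Q ≤ a ^ 2 * ∫ ω, y ω ^ 2 ∂Q := by
    rw [integral_inner_sq hM hX' hX]
    refine (dotProduct_mulVec_le_norm _ _).trans (le_trans (le_of_eq ?_) hα)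
    rw [EuclideanSpace.real_norm_sq_eq]
    simp [dotProduct, sq]
  have key := abs_integral_sub_sq_sub_le hXL hyL ha hle
  rw [h0, div_sub_one hy.ne', abs_div, abs_of_pos hy, div_le_iff₀ hy]
  exact key

/-! ### Linear combinations of independent random vectors -/

open Matrix in
theorem dotProduct_kroneckerMap_mulVec {n p : ℕ} (w : Fin n → ℝ) (S : Matrix (Fin p) (Fin p) ℝ)
    (x : Fin n × Fin p → ℝ) :
    x ⬝ᵥ kroneckerMap (· * ·) (vecMulVec w w) S *ᵥ x =
      (fun j => ∑ i, w i * x (i, j)) ⬝ᵥ S *ᵥ fun j => ∑ i, w i * x (i, j) := by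
  simp only [dotProduct, mulVec, kroneckerMap_apply, vecMulVec_apply, Fintype.sum_prod_type_right,
    Finset.mul_sum, Finset.sum_mul]
  refine Finset.sum_congr rfl fun j _ => ?_
  rw [Finset.sum_comm]
  refine Finset.sum_congr rfl fun j' _ => ?_
  rw [Finset.sum_comm]
  refine Finset.sum_congr rfl fun i' _ => Finset.sum_congr rfl fun i _ => ?_
  ring

open Matrix in
-- Cauchy–Schwarz in each column. It says `wwᵀ ⊗ I ≤ I`, so passing to the Kronecker product does
-- not increase the upper bound `η`.
theorem dotProduct_sum_le {n p : ℕ} {w : Fin n → ℝ} (hw : w ⬝ᵥ w = 1) (x : Fin n × Fin p → ℝ) :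
    (fun j => ∑ i, w i * x (i, j)) ⬝ᵥ (fun j => ∑ i, w i * x (i, j)) ≤ x ⬝ᵥ x := by
  have hw' : ∑ i, w i ^ 2 = 1 := by rw [← hw]; simp [dotProduct, sq]
  simp only [dotProduct, Fintype.sum_prod_type_right]
  refine Finset.sum_le_sum fun j _ => ?_
  rw [← sq]
  calc _ ≤ (∑ i, w i ^ 2) * ∑ i, x (i, j) ^ 2 := Finset.sum_mul_sq_le_sq_mul_sq _ _ _
    _ = _ := by rw [hw', one_mul]; simp [sq]

open Matrix in
theorem lintegral_exp_block_quadraticForm_le {n p : ℕ} (μ : Fin p → Measure ℝ)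
    [∀ j, IsProbabilityMeasure (μ j)] {s C η k κ : ℝ} (hs : s = 1 ∨ s = -1) (hC : 0 ≤ C)
    (hη : 0 < η) (hCη : 8 * C * η ≤ 1) (hk : k ≤ κ) (hk' : k ≤ κ * (1 - 4 * s * C * η))
    (hμ : ∀ j a b, 0 ≤ a → a ≤ η →
      ∫⁻ x, ENNReal.ofReal (Real.exp (s * (a * x ^ 2) + b * x)) ∂(μ j) ≤
        ENNReal.ofReal (Real.exp (k * a + C * b ^ 2)))
    {A : Matrix (Fin p) (Fin p) ℝ} (hA : A.IsSymm) (hpos : ∀ x, 0 ≤ x ⬝ᵥ A *ᵥ x)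
    (hle : ∀ x, x ⬝ᵥ A *ᵥ x ≤ η * (x ⬝ᵥ x)) {w : Fin n → ℝ} (hw : w ⬝ᵥ w = 1) :
    ∫⁻ x, ENNReal.ofReal (Real.exp (s * ((fun j => ∑ i, w i * x i j) ⬝ᵥ
        A *ᵥ fun j => ∑ i, w i * x i j))) ∂Measure.pi (fun _ : Fin n => Measure.pi μ) ≤
      ENNReal.ofReal (Real.exp (κ * A.trace)) := by
  have hmap : ∀ i j, (Measure.pi fun _ : Fin n => Measure.pi μ).map (fun x => x i j) = μ j := by
    intro i j
    have h := (measurePreserving_eval μ j).comp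
      (measurePreserving_eval (fun _ : Fin n => Measure.pi μ) i)
    exact h.map_eq
  have hind : iIndepFun (fun (q : Fin n × Fin p) (x : Fin n → Fin p → ℝ) => x q.1 q.2)
      (Measure.pi fun _ : Fin n => Measure.pi μ) := by
    refine iIndepFun_uncurry' (X := fun i j (x : Fin n → Fin p → ℝ) => x i j)
      (fun i j => by fun_prop) ?_ fun i => ?_
    · exact iIndepFun_pi (μ := fun _ : Fin n => Measure.pi μ)
        (X := fun _ (z : Fin p → ℝ) => z) fun i => by fun_prop
    · rw [iIndepFun_iff_map_fun_eq_pi_map fun j =>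
        (by fun_prop : Measurable fun x : Fin n → Fin p → ℝ => x i j).aemeasurable]
      simp only [hmap]
      exact (measurePreserving_eval (fun _ : Fin n => Measure.pi μ) i).map_eq
  have hK : (kroneckerMap (· * ·) (vecMulVec w w) A).IsSymm := by
    ext ⟨i, j⟩ ⟨i', j'⟩
    simp [vecMulVec_apply, hA.apply j j', mul_comm]
  have htr : (kroneckerMap (· * ·) (vecMulVec w w) A).trace = A.trace := by
    have : (kroneckerMap (· * ·) (vecMulVec w w) A).trace = (vecMulVec w w).trace * A.trace :=
      trace_kronecker _ _
    rw [this, trace_vecMulVec, hw, one_mul]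
  have key := lintegral_exp_quadraticForm_le_of_iIndepFun hind (fun q => by fun_prop) hs hC hη hCη
    hk hk' (fun q => by rw [hmap]; exact hμ q.2) hK
    (fun x => by rw [dotProduct_kroneckerMap_mulVec]; exact hpos _)
    (fun x => by
      rw [dotProduct_kroneckerMap_mulVec]
      exact (hle _).trans (mul_le_mul_of_nonneg_left (dotProduct_sum_le hw x) hη.le))
  simpa only [dotProduct_kroneckerMap_mulVec, htr] using key

theorem measure_ge_le_of_lintegral_exp_le {Ω : Type*} [MeasurableSpace Ω] {P : Measure Ω}
    [IsProbabilityMeasure P] {f : Ω → ℝ} (hf : AEMeasurable f P) {a : ℝ}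
    (h : ∫⁻ ω, ENNReal.ofReal (Real.exp (f ω)) ∂P ≤ ENNReal.ofReal (Real.exp a)) (t : ℝ) :
    P.real {ω | t ≤ f ω} ≤ Real.exp (a - t) := by
  have hm := mul_meas_ge_le_lintegral₀ (μ := P)
    (f := fun ω => ENNReal.ofReal (Real.exp (f ω))) (by fun_prop) (ENNReal.ofReal (Real.exp t))
  have hset : {ω | ENNReal.ofReal (Real.exp t) ≤ ENNReal.ofReal (Real.exp (f ω))} =
      {ω | t ≤ f ω} := by
    ext ω
    simp [ENNReal.ofReal_le_ofReal_iff (Real.exp_pos _).le]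
  rw [hset] at hm
  have := ENNReal.toReal_le_of_le_ofReal (Real.exp_pos _).le (hm.trans h)
  rw [ENNReal.toReal_mul, ENNReal.toReal_ofReal (Real.exp_pos _).le] at this
  rw [Real.exp_sub, le_div_iff₀ (Real.exp_pos _), mul_comm]
  exact this

/-! ### Laws of the sample -/

section Sample

variable {Ω₀ Ω : Type*} [MeasurableSpace Ω₀] [MeasurableSpace Ω] {n p : ℕ}
  {Q : Measure Ω₀} {X : Ω₀ → EuclideanSpace ℝ (Fin p)} {y : Ω₀ → ℝ} {P : Measure Ω}
  {Xs : Fin n → Ω → EuclideanSpace ℝ (Fin p)} {ys : Fin n → Ω → ℝ}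

/-- The latent variables live on the space of `(X, y)`, not on that of the sample. Matching joint
laws moves every computation to a product space where they are available. -/
theorem identDistrib_pi_of_iIndepFun {E Ω' : Type*} [MeasurableSpace E] [MeasurableSpace Ω']
    {ν : Measure Ω'} [IsProbabilityMeasure ν] {Z : Fin n → Ω → E} {g : Ω' → E}
    (hg : AEMeasurable g ν) (hZ : iIndepFun Z P) (h : ∀ i, IdentDistrib (Z i) g P ν) :
    IdentDistrib (fun ω i => Z i ω) (fun x i => g (x i)) P (Measure.pi fun _ : Fin n => ν) := by
  refine IdentDistrib.pi (fun i => (h i).trans ?_) hZ (iIndepFun_pi fun i => hg)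
  have hev := measurePreserving_eval (fun _ : Fin n => ν) i
  refine ⟨hg, hg.comp_quasiMeasurePreserving hev.quasiMeasurePreserving, ?_⟩
  have hmap := AEMeasurable.map_map_of_aemeasurable (by rwa [hev.map_eq]) hev.aemeasurable (g := g)
  rw [hev.map_eq] at hmap
  exact hmap

theorem IsIIDSample.identDistrib_features [IsProbabilityMeasure Q]
    (hS : IsIIDSample Q X y P Xs ys) {X' : Fin p → Ω₀ → ℝ} {B : Matrix (Fin p) (Fin p) ℝ}
    (hX'm : ∀ j, AEMeasurable (X' j) Q) (hX'i : iIndepFun X' Q)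
    (hX : ∀ᵐ ω ∂Q, X ω = WithLp.toLp 2 (Matrix.mulVec B fun j => X' j ω)) :
    IdentDistrib (fun ω i => Xs i ω) (fun x i => WithLp.toLp 2 (Matrix.mulVec B (x i))) P
      (Measure.pi fun _ : Fin n => Measure.pi fun j => Q.map (X' j)) := by
  have : ∀ j, IsProbabilityMeasure (Q.map (X' j)) := fun j =>
    Measure.isProbabilityMeasure_map (hX'm j)
  have hg : Measurable fun x : Fin p → ℝ => WithLp.toLp 2 (Matrix.mulVec B x) :=
    Continuous.measurable (by fun_prop)
  have hX'v : AEMeasurable (fun ω j => X' j ω) Q := aemeasurable_pi_lambda _ hX'm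
  have hi : iIndepFun Xs P := hS.indep.comp (fun _ => Prod.fst) fun _ => measurable_fst
  refine identDistrib_pi_of_iIndepFun (g := fun x => WithLp.toLp 2 (Matrix.mulVec B x))
    hg.aemeasurable hi fun i => ?_
  have h1 : IdentDistrib (Xs i) X P Q := (hS.identDistrib i).comp measurable_fst
  refine h1.trans ⟨h1.aemeasurable_snd, hg.aemeasurable, ?_⟩
  rw [Measure.map_congr hX, ← (iIndepFun_iff_map_fun_eq_pi_map hX'm).mp hX'i,
    AEMeasurable.map_map_of_aemeasurable hg.aemeasurable hX'v]
  rfl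

theorem IsIIDSample.lintegral_exp_sum_sq_le [IsProbabilityMeasure Q]
    (hS : IsIIDSample Q X y P Xs ys) (hym : AEMeasurable y Q) {τ : ℝ}
    (hy : ∫⁻ ω, ENNReal.ofReal (Real.exp (y ω ^ 2 / τ)) ∂Q ≤ 2) :
    ∫⁻ ω, ENNReal.ofReal (Real.exp ((∑ i, ys i ω ^ 2) / τ)) ∂P ≤ 2 ^ n := by
  have hi : iIndepFun ys P := hS.indep.comp (fun _ => Prod.snd) fun _ => measurable_snd
  have := Measure.isProbabilityMeasure_map hym (μ := Q)
  have hid : IdentDistrib (fun ω i => ys i ω) (fun x i => x i) P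
      (Measure.pi fun _ : Fin n => Q.map y) := by
    refine identDistrib_pi_of_iIndepFun (g := fun x => x) aemeasurable_id hi fun i => ?_
    have h1 : IdentDistrib (ys i) y P Q := (hS.identDistrib i).comp measurable_snd
    exact h1.trans ⟨hym, by fun_prop, by rw [Measure.map_id']⟩
  have hF : Measurable fun x : Fin n → ℝ => ENNReal.ofReal (Real.exp ((∑ i, x i ^ 2) / τ)) := by
    fun_prop
  have hprod : ∀ x : Fin n → ℝ, ENNReal.ofReal (Real.exp ((∑ i, x i ^ 2) / τ)) =
      ∏ i, ENNReal.ofReal (Real.exp (x i ^ 2 / τ)) := fun x => by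
    rw [← ENNReal.ofReal_prod_of_nonneg fun i _ => (Real.exp_pos _).le, ← Real.exp_sum,
      Finset.sum_div]
  have e := (hid.comp hF).lintegral_eq
  simp only [Function.comp_def] at e
  rw [e]
  simp only [hprod]
  rw [lintegral_prod_eq_prod_lintegral_of_indepFun Finset.univ
    (fun i (x : Fin n → ℝ) => ENNReal.ofReal (Real.exp (x i ^ 2 / τ)))
    (iIndepFun_pi (μ := fun _ : Fin n => Q.map y)
      (X := fun _ (z : ℝ) => ENNReal.ofReal (Real.exp (z ^ 2 / τ))) fun i => by fun_prop)
    fun i => by fun_prop]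
  calc _ ≤ ∏ _i : Fin n, (2 : ℝ≥0∞) := by
        refine Finset.prod_le_prod' fun i _ => ?_
        have hev := measurePreserving_eval (fun _ : Fin n => Q.map y) i
        have h2 := hev.lintegral_comp (f := fun z : ℝ => ENNReal.ofReal (Real.exp (z ^ 2 / τ)))
          (by fun_prop)
        refine le_trans (le_of_eq h2) ?_
        rw [lintegral_map' (by fun_prop) hym]
        exact hy
    _ = 2 ^ n := by simp

end Sample

/-! ### Concentration of the design matrix -/

theorem norm_pos_of_effectiveRank_pos {p : ℕ} {S : Matrix (Fin p) (Fin p) ℝ}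
    (h : 0 < effectiveRank S) : 0 < ‖Matrix.toEuclideanCLM (𝕜 := ℝ) S‖ := by
  refine (norm_nonneg _).lt_of_ne' fun h0 => ?_
  rw [effectiveRank, h0, div_zero] at h
  exact h.false

theorem trace_pos_of_effectiveRank_pos {p : ℕ} {S : Matrix (Fin p) (Fin p) ℝ}
    (h : 0 < effectiveRank S) : 0 < S.trace :=
  (div_pos_iff_of_pos_right (norm_pos_of_effectiveRank_pos h)).mp h

section Concentration

variable {Ω₀ Ω : Type*} [MeasurableSpace Ω₀] [MeasurableSpace Ω] {n p : ℕ}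
  {Q : Measure Ω₀} {X : Ω₀ → EuclideanSpace ℝ (Fin p)} {y : Ω₀ → ℝ}
  {P : Measure Ω}
  {Xs : Fin n → Ω → EuclideanSpace ℝ (Fin p)} {ys : Fin n → Ω → ℝ} {M : ℝ}

theorem IsIIDSample.aemeasurable_norm_sum_sq (hS : IsIIDSample Q X y P Xs ys) (w : Fin n → ℝ) :
    AEMeasurable (fun ω => ‖∑ i, w i • Xs i ω‖ ^ 2) P := by
  have h : ∀ i, AEMeasurable (Xs i) P := fun i =>
    measurable_fst.comp_aemeasurable (hS.identDistrib i).aemeasurable_fst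
  fun_prop

variable [IsProbabilityMeasure Q]

open Matrix in
theorem IsIIDSample.lintegral_exp_norm_sq_le (hM : 0 < M) (hXy : SubGaussianPair Q M X y)
    (hS : IsIIDSample Q X y P Xs ys) {s C η k κ lam : ℝ} (hs : s = 1 ∨ s = -1) (hC : 0 ≤ C)
    (hη : 0 < η) (hCη : 8 * C * η ≤ 1) (hk : k ≤ κ) (hk' : k ≤ κ * (1 - 4 * s * C * η))
    (hμ : ∀ (μ : Measure ℝ) [IsProbabilityMeasure μ],
      ∫⁻ x, ENNReal.ofReal (Real.exp (x ^ 2 / (2 * M) ^ 2)) ∂μ ≤ 2 → ∫ x, x ∂μ = 0 →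
      ∫ x, x ^ 2 ∂μ = 1 → ∀ a b, 0 ≤ a → a ≤ η →
      ∫⁻ x, ENNReal.ofReal (Real.exp (s * (a * x ^ 2) + b * x)) ∂μ ≤
        ENNReal.ofReal (Real.exp (k * a + C * b ^ 2)))
    (hlam : 0 ≤ lam) (hlamη : lam * ‖toEuclideanCLM (𝕜 := ℝ) (covMatrix Q X)‖ ≤ η)
    {w : Fin n → ℝ} (hw : w ⬝ᵥ w = 1) :
    ∫⁻ ω, ENNReal.ofReal (Real.exp (s * (lam * ‖∑ i, w i • Xs i ω‖ ^ 2))) ∂P ≤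
      ENNReal.ofReal (Real.exp (κ * (lam * (covMatrix Q X).trace))) := by
  obtain ⟨X', y', hX'i, hX', hy', hX, hyy'⟩ := hXy
  have hPSD := posSemidef_covMatrix hM hX' hX
  set S := covMatrix Q X with hSdef
  set B := CFC.sqrt S with hB
  -- Positive semi-definiteness is what makes `CFC.sqrt` an actual square root here.
  have hBB : B * B = S := CFC.sqrt_mul_sqrt_self S hPSD.nonneg
  have hBsymm : Bᵀ = B := by
    have : B.PosSemidef := nonneg_iff_posSemidef.mp (CFC.sqrt_nonneg S)
    simpa using this.isHermitian.eq
  have hSsymm : S.IsSymm := (conjTranspose_eq_transpose_of_trivial S).symm.trans hPSD.isHermitian.eq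
  have hSpos : ∀ x : Fin p → ℝ, 0 ≤ x ⬝ᵥ S *ᵥ x := fun x => by
    simpa using hPSD.dotProduct_mulVec_nonneg x
  have : ∀ j, IsProbabilityMeasure (Q.map (X' j)) := fun j =>
    Measure.isProbabilityMeasure_map (hX' j).aemeasurable
  have hid := hS.identDistrib_features (fun j => (hX' j).aemeasurable) hX'i hX
  have hF : Measurable fun x : Fin n → EuclideanSpace ℝ (Fin p) =>
      ENNReal.ofReal (Real.exp (s * (lam * ‖∑ i, w i • x i‖ ^ 2))) := by fun_prop
  have e := (hid.comp hF).lintegral_eq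
  simp only [Function.comp_def] at e
  rw [e]
  have hnorm : ∀ x : Fin n → Fin p → ℝ, ‖∑ i, w i • WithLp.toLp 2 (B *ᵥ x i)‖ ^ 2 =
      (fun j => ∑ i, w i * x i j) ⬝ᵥ S *ᵥ fun j => ∑ i, w i * x i j := fun x => by
    have h1 : ∑ i, w i • WithLp.toLp 2 (B *ᵥ x i) =
        WithLp.toLp 2 (B *ᵥ fun j => ∑ i, w i * x i j) := by
      have h2 : (fun j => ∑ i, w i * x i j) = ∑ i, w i • x i := by
        ext j; simp [Finset.sum_apply]
      rw [h2, mulVec_sum, WithLp.toLp_sum]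
      simp [mulVec_smul]
    rw [h1, ← real_inner_self_eq_norm_sq, EuclideanSpace.inner_toLp_toLp, star_trivial, ← hBB,
      ← mulVec_mulVec, dotProduct_mulVec _ B (B *ᵥ _), ← mulVec_transpose, hBsymm]
  simp only [hnorm]
  have key := lintegral_exp_block_quadraticForm_le (fun j => Q.map (X' j)) hs hC hη hCη hk hk'
    (fun j => hμ _ ((hX' j).lintegral_map_exp_sq_le hM) (hX' j).integral_map_eq_zero
      (hX' j).integral_map_sq) (A := lam • S) (hSsymm.smul lam)
    (fun x => by
      rw [smul_mulVec, dotProduct_smul, smul_eq_mul]; exact mul_nonneg hlam (hSpos x))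
    (fun x => by
      rw [smul_mulVec, dotProduct_smul, smul_eq_mul]
      have hxx : 0 ≤ x ⬝ᵥ x := Finset.sum_nonneg fun i _ => mul_self_nonneg _
      calc lam * (x ⬝ᵥ S *ᵥ x) ≤ lam * (‖toEuclideanCLM (𝕜 := ℝ) S‖ * (x ⬝ᵥ x)) := by
            gcongr; exact dotProduct_mulVec_le_norm S x
        _ ≤ η * (x ⬝ᵥ x) := by rw [← mul_assoc]; gcongr)
    hw
  simpa only [smul_mulVec, dotProduct_smul, smul_eq_mul, trace_smul] using key

/-- The radius, in units of the inverse operator norm of the covariance, up to which the exponential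
moments of the quadratic forms are controlled. -/
noncomputable def mgfRadius (T : ℝ) : ℝ := 1 / (16 * (T ^ 2 + T ^ 4))

theorem mgfRadius_pos {T : ℝ} (hT : 0 < T) : 0 < mgfRadius T := by
  unfold mgfRadius; positivity

theorem mgfRadius_mul_sq_le {T : ℝ} (hT : 0 < T) : 16 * T ^ 2 * mgfRadius T ≤ 1 := by
  unfold mgfRadius
  rw [mul_one_div, div_le_one (by positivity)]
  nlinarith [pow_pos hT 4]

theorem mgfRadius_mul_pow_four_le {T : ℝ} (hT : 0 < T) : 16 * T ^ 4 * mgfRadius T ≤ 1 := by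
  unfold mgfRadius
  rw [mul_one_div, div_le_one (by positivity)]
  nlinarith [pow_pos hT 2]

variable [IsProbabilityMeasure P]

open Matrix in
-- Chernoff at `lam = η / ‖Σ‖`, the largest scale allowed, where `lam * tr Σ = η r_e`. The threshold
-- exceeds `κ = 2T²` by one, which leaves exactly `-η r_e`.
theorem IsIIDSample.measure_norm_sq_ge_le (hM : 0 < M) (hXy : SubGaussianPair Q M X y)
    (hS : IsIIDSample Q X y P Xs ys) (hr : 0 < effectiveRank (covMatrix Q X))
    {w : Fin n → ℝ} (hw : w ⬝ᵥ w = 1) :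
    P.real {ω | (2 * (2 * M) ^ 2 + 1) * (covMatrix Q X).trace ≤ ‖∑ i, w i • Xs i ω‖ ^ 2} ≤
      Real.exp (-(mgfRadius (2 * M) * effectiveRank (covMatrix Q X))) := by
  set T := 2 * M with hT
  have hT0 : 0 < T := by positivity
  set η := mgfRadius T
  have hη : 0 < η := mgfRadius_pos hT0
  have hη2 : 16 * T ^ 2 * η ≤ 1 := mgfRadius_mul_sq_le hT0
  set N := ‖toEuclideanCLM (𝕜 := ℝ) (covMatrix Q X)‖ with hN
  have hN0 : 0 < N := norm_pos_of_effectiveRank_pos hr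
  have key := hS.lintegral_exp_norm_sq_le hM hXy (s := 1) (C := 2 * T ^ 2) (η := η) (k := T ^ 2)
    (κ := 2 * T ^ 2) (lam := η / N) (Or.inl rfl) (by positivity) hη (by linarith)
    (by nlinarith [sq_nonneg T]) (by nlinarith [sq_nonneg T])
    (fun μ _ h1 h2 h3 a b ha hab => by
      simpa only [one_mul] using lintegral_exp_sq_add_linear_le hT0 h1 h2 ha
        (by nlinarith [sq_nonneg T]) b)
    (by positivity) (by rw [← hN]; exact le_of_eq (by field_simp)) hw
  have := measure_ge_le_of_lintegral_exp_le
    (((hS.aemeasurable_norm_sum_sq w).const_mul _).const_mul _) key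
    (1 * (η / N * ((2 * T ^ 2 + 1) * (covMatrix Q X).trace)))
  have hpos : 0 < η / N := by positivity
  simp only [one_mul, mul_le_mul_iff_right₀ hpos] at this
  refine this.trans (le_of_eq ?_)
  congr 1
  rw [effectiveRank, ← hN]
  field_simp
  ring

open Matrix in
-- The same argument for `s = -1`. The moment rate drops from `-3/4` for one variable to `-1/2` for
-- the form, and the threshold `1/4` spends half of that.
theorem IsIIDSample.measure_norm_sq_le_le (hM : 0 < M) (hXy : SubGaussianPair Q M X y)
    (hS : IsIIDSample Q X y P Xs ys) (hr : 0 < effectiveRank (covMatrix Q X))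
    {w : Fin n → ℝ} (hw : w ⬝ᵥ w = 1) :
    P.real {ω | ‖∑ i, w i • Xs i ω‖ ^ 2 ≤ (covMatrix Q X).trace / 4} ≤
      Real.exp (-(mgfRadius (2 * M) * effectiveRank (covMatrix Q X) / 4)) := by
  set T := 2 * M with hT
  have hT0 : 0 < T := by positivity
  set η := mgfRadius T
  have hη : 0 < η := mgfRadius_pos hT0
  have hη2 : 16 * T ^ 2 * η ≤ 1 := mgfRadius_mul_sq_le hT0
  have hη4 : 16 * T ^ 4 * η ≤ 1 := mgfRadius_mul_pow_four_le hT0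
  set N := ‖toEuclideanCLM (𝕜 := ℝ) (covMatrix Q X)‖ with hN
  have hN0 : 0 < N := norm_pos_of_effectiveRank_pos hr
  have key := hS.lintegral_exp_norm_sq_le hM hXy (s := -1) (C := 2 * T ^ 2) (η := η)
    (k := -(3 / 4)) (κ := -(1 / 2)) (lam := η / N) (Or.inr rfl) (by positivity) hη (by linarith)
    (by norm_num) (by nlinarith)
    (fun μ _ h1 h2 h3 a b ha hab => by
      simpa only [neg_one_mul] using lintegral_exp_neg_sq_add_linear_le hT0 h1 h2 h3 ha
        (by nlinarith [pow_pos hT0 4]) b)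
    (by positivity) (by rw [← hN]; exact le_of_eq (by field_simp)) hw
  have := measure_ge_le_of_lintegral_exp_le
    (((hS.aemeasurable_norm_sum_sq w).const_mul _).const_mul _) key
    (-1 * (η / N * ((covMatrix Q X).trace / 4)))
  have hpos : 0 < η / N := by positivity
  simp only [neg_one_mul, neg_le_neg_iff, mul_le_mul_iff_right₀ hpos] at this
  refine this.trans (le_of_eq ?_)
  congr 1
  rw [effectiveRank, ← hN]
  field_simp
  ring

/-- The normalized sum of squares has exponential moment at most `2ⁿ ≤ eⁿ`, so Markov's inequality
at level `2n` leaves `e⁻ⁿ`. -/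
theorem IsIIDSample.measure_sum_sq_ge_le (hM : 0 < M) (hXy : SubGaussianPair Q M X y)
    (hS : IsIIDSample Q X y P Xs ys) (hy : 0 < ∫ ω, y ω ^ 2 ∂Q) :
    P.real {ω | 2 * (2 * M) ^ 2 * (∫ ω, y ω ^ 2 ∂Q) * n ≤ ∑ i, ys i ω ^ 2} ≤ Real.exp (-n) := by
  obtain ⟨X', y', -, -, hy', -, hyy'⟩ := hXy
  set σ2 := ∫ ω, y ω ^ 2 ∂Q with hσ
  have hτ : 0 < (2 * M) ^ 2 * σ2 := by positivity
  have hym : AEMeasurable y Q := (hy'.aemeasurable.const_mul _).congr (hyy'.mono fun ω h => h.symm)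
  have h1 : ∫⁻ ω, ENNReal.ofReal (Real.exp (y ω ^ 2 / ((2 * M) ^ 2 * σ2))) ∂Q ≤ 2 := by
    refine le_trans (le_of_eq (lintegral_congr_ae ?_)) (hy'.lintegral_exp_sq_le hM)
    filter_upwards [hyy'] with ω hω
    rw [hω, mul_pow, Real.sq_sqrt hy.le]
    congr 2
    field_simp
  have h2 := hS.lintegral_exp_sum_sq_le hym h1
  have h3 : (2 : ℝ≥0∞) ^ n ≤ ENNReal.ofReal (Real.exp n) := by
    rw [← mul_one (n : ℝ), Real.exp_nat_mul, ENNReal.ofReal_pow (Real.exp_pos _).le]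
    gcongr
    rw [show (2 : ℝ≥0∞) = ENNReal.ofReal 2 by simp]
    apply ENNReal.ofReal_le_ofReal
    linarith [Real.add_one_le_exp 1]
  have hm : AEMeasurable (fun ω => (∑ i, ys i ω ^ 2) / ((2 * M) ^ 2 * σ2)) P := by
    have h : ∀ i, AEMeasurable (ys i) P := fun i =>
      measurable_snd.comp_aemeasurable (hS.identDistrib i).aemeasurable_fst
    fun_prop
  have h4 := measure_ge_le_of_lintegral_exp_le hm (h2.trans h3) (2 * n)
  simp only [le_div_iff₀ hτ] at h4
  convert h4 using 3
  · ext ω; rw [show 2 * (2 * M) ^ 2 * σ2 * n = 2 * n * ((2 * M) ^ 2 * σ2) by ring]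
  · ring

end Concentration

/-! ### The finite-sample bound -/

open Matrix in
theorem toEuclideanLin_transpose_of_apply {n p : ℕ} (x : Fin n → EuclideanSpace ℝ (Fin p))
    (w : EuclideanSpace ℝ (Fin n)) :
    toEuclideanLin (Matrix.of fun i j => x i j)ᵀ w = ∑ i, w i • x i := by
  ext j
  simp [toLpLin_apply, mulVec, dotProduct, mul_comm]

/-- On the event where the design is well conditioned on a net of the sphere and the responses are
not too large, the estimator is short. -/
theorem norm_sq_sampleEstimator_le {Ω : Type*} {n p : ℕ}
    {Xs : Fin n → Ω → EuclideanSpace ℝ (Fin p)} {ys : Fin n → Ω → ℝ} {ω : Ω}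
    {s : Finset (EuclideanSpace ℝ (Fin n))} {κ t b : ℝ} (hκ : 1 ≤ κ) (ht : 0 < t)
    (hnet : ∀ x : EuclideanSpace ℝ (Fin n), ‖x‖ = 1 → ∃ c ∈ s, ‖x - c‖ ≤ 1 / (8 * √κ))
    (hup : ∀ c ∈ s, ‖∑ i, c i • Xs i ω‖ ^ 2 ≤ κ * t)
    (hlow : ∀ c ∈ s, t / 4 ≤ ‖∑ i, c i • Xs i ω‖ ^ 2) (hy : ∑ i, ys i ω ^ 2 ≤ b) :
    t * ‖sampleEstimator Xs ys ω‖ ^ 2 ≤ 16 * b := by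
  have hκ1 : 1 ≤ √κ := Real.one_le_sqrt.mpr hκ
  set A : Matrix (Fin n) (Fin p) ℝ := Matrix.of fun i j => Xs i ω j with hA
  set L : EuclideanSpace ℝ (Fin n) →L[ℝ] EuclideanSpace ℝ (Fin p) :=
    LinearMap.toContinuousLinearMap (Matrix.toEuclideanLin A.transpose) with hL
  have hLc : ∀ c, L c = ∑ i, c i • Xs i ω := fun c =>
    toEuclideanLin_transpose_of_apply (fun i => Xs i ω) c
  have h1 := mul_norm_le_of_net L (s := s) (ε := 1 / (8 * √κ)) (a := √(κ * t)) (b := √t / 2)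
    (Real.sqrt_nonneg _) (by rw [div_le_div_iff₀ (by positivity) (by norm_num)]; linarith) hnet
    (fun c hc => by rw [hLc]; exact Real.le_sqrt_of_sq_le (hup c hc))
    (fun c hc => by
      rw [hLc]
      refine (sq_le_sq₀ (by positivity) (norm_nonneg _)).mp ?_
      rw [div_pow, Real.sq_sqrt ht.le]
      linarith [hlow c hc])
  -- The mesh `1 / (8√κ)` is chosen so that the net error costs half of the lower bound `√t / 2`.
  have e : √t / 2 - 2 * √(κ * t) * (1 / (8 * √κ)) = √t / 4 := by
    rw [Real.sqrt_mul (by linarith)]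
    field_simp
    ring
  rw [e] at h1
  have hst : 0 < √t := Real.sqrt_pos.mpr ht
  have h2 := norm_minNormEstimator_le A (WithLp.toLp 2 fun i => ys i ω) (s := √t / 4)
    (by positivity) h1
  change √t / 4 * ‖sampleEstimator Xs ys ω‖ ≤ _ at h2
  have h3 := pow_le_pow_left₀ (by positivity) h2 2
  rw [EuclideanSpace.real_norm_sq_eq, mul_pow, div_pow, Real.sq_sqrt ht.le] at h3
  simp only at h3
  linarith

theorem IsIIDSample.measure_bad_design_le {Ω₀ Ω : Type*} [MeasurableSpace Ω₀] [MeasurableSpace Ω]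
    {n p : ℕ} {Q : Measure Ω₀} [IsProbabilityMeasure Q] {X : Ω₀ → EuclideanSpace ℝ (Fin p)}
    {y : Ω₀ → ℝ} {P : Measure Ω} [IsProbabilityMeasure P]
    {Xs : Fin n → Ω → EuclideanSpace ℝ (Fin p)} {ys : Fin n → Ω → ℝ} {M : ℝ}
    (hM : 0 < M) (hXy : SubGaussianPair Q M X y) (hS : IsIIDSample Q X y P Xs ys)
    (hr : 0 < effectiveRank (covMatrix Q X))
    (s : Finset (EuclideanSpace ℝ (Fin n))) (hs : ∀ c ∈ s, ‖c‖ = 1) :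
    P.real (⋃ c ∈ s,
        ({ω | (2 * (2 * M) ^ 2 + 1) * (covMatrix Q X).trace ≤ ‖∑ i, c i • Xs i ω‖ ^ 2} ∪
          {ω | ‖∑ i, c i • Xs i ω‖ ^ 2 ≤ (covMatrix Q X).trace / 4})) ≤
      s.card * (2 * Real.exp (-(mgfRadius (2 * M) * effectiveRank (covMatrix Q X) / 4))) := by
  refine (measureReal_biUnion_finset_le s _).trans ?_
  rw [← nsmul_eq_mul]
  refine Finset.sum_le_card_nsmul _ _ _ fun c hc => ?_
  have hw : c.ofLp ⬝ᵥ c.ofLp = 1 := by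
    have := EuclideanSpace.real_norm_sq_eq c
    rw [hs c hc] at this
    simpa [dotProduct, sq] using this.symm
  refine (measureReal_union_le _ _).trans ?_
  rw [two_mul (Real.exp _)]
  refine add_le_add ((hS.measure_norm_sq_ge_le hM hXy hr hw).trans ?_)
    (hS.measure_norm_sq_le_le hM hXy hr hw)
  have : 0 < mgfRadius (2 * M) * effectiveRank (covMatrix Q X) :=
    mul_pos (mgfRadius_pos (by positivity)) hr
  exact Real.exp_le_exp.mpr (by linarith)

theorem exists_finite_sample_bound {M : ℝ} (hM : 0 < M) :
    ∃ C c c' K : ℝ, 1 < C ∧ 0 < c ∧ 0 < c' ∧ 0 < K ∧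
      ∀ (n p : ℕ) (Ω₀ : Type u) (Ω : Type v) [MeasurableSpace Ω₀] [MeasurableSpace Ω]
        (Q : Measure Ω₀) (P : Measure Ω) [IsProbabilityMeasure Q] [IsProbabilityMeasure P]
        (X : Ω₀ → EuclideanSpace ℝ (Fin p)) (y : Ω₀ → ℝ)
        (Xs : Fin n → Ω → EuclideanSpace ℝ (Fin p)) (ys : Fin n → Ω → ℝ),
        SubGaussianPair Q M X y → 0 < ∫ ω, y ω ^ 2 ∂Q → IsIIDSample Q X y P Xs ys →
        C * n < effectiveRank (covMatrix Q X) →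
        1 - c * Real.exp (-(c' * n)) ≤
          P.real {ω | |risk Q X y (sampleEstimator Xs ys ω) / risk Q X y 0 - 1| ≤
            K * √(n / effectiveRank (covMatrix Q X))} := by
  set T := 2 * M with hT
  have hT0 : 0 < T := by positivity
  set η := mgfRadius T with hη
  have hη0 : 0 < η := mgfRadius_pos hT0
  set κ := 2 * T ^ 2 + 1 with hκ
  have hκ1 : 1 ≤ κ := by rw [hκ]; nlinarith [sq_nonneg T]
  set ε := 1 / (8 * √κ) with hε
  have hκs : 0 < √κ := Real.sqrt_pos.mpr (by linarith)
  have hε0 : 0 < ε := by positivity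
  have hlog : 0 < Real.log (1 + 2 / ε) := Real.log_pos (by
    have : 0 < 2 / ε := by positivity
    linarith)
  -- In `C`, the summand `1` gives `n < r_e`, and the rest lets `exp(-η r_e / 4)` absorb the net
  -- cardinality and still leave `e⁻ⁿ`. The `3` counts two tails of the design and one of the
  -- responses. `K` is `a² + 2a` with `a = 6T√(n / r_e)`, after bounding `n / r_e` by its square
  -- root.
  refine ⟨1 + 4 * (1 + Real.log (1 + 2 / ε)) / η, 3, 1, 36 * T ^ 2 + 12 * T,
    by have : 0 < 4 * (1 + Real.log (1 + 2 / ε)) / η := by positivity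
       linarith, by norm_num, by norm_num, by positivity, ?_⟩
  intro n p Ω₀ Ω _ _ Q P _ _ X y Xs ys hXy hy hS hCr
  -- For `n = 0` the claimed lower bound is `1 - 3 < 0`. The main argument needs `a > 0`, hence `n >
  -- 0`.
  rcases Nat.eq_zero_or_pos n with hn | hn
  · refine le_trans ?_ measureReal_nonneg
    simp [hn]
  set r := effectiveRank (covMatrix Q X) with hr
  have hn' : (0 : ℝ) < n := by exact_mod_cast hn
  have hC0 : 0 < 4 * (1 + Real.log (1 + 2 / ε)) / η := by positivity
  have hrn : (n : ℝ) < r := by nlinarith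
  have hr0 : 0 < r := hn'.trans hrn
  have htr : 0 < (covMatrix Q X).trace := trace_pos_of_effectiveRank_pos hr0
  have hηr : n + n * Real.log (1 + 2 / ε) ≤ η * r / 4 := by
    have h1 : 4 * (1 + Real.log (1 + 2 / ε)) / η * n ≤ r := by nlinarith
    rw [div_mul_eq_mul_div, div_le_iff₀ hη0] at h1
    linarith
  obtain ⟨s, hs1, hcard, hnet⟩ :=
    exists_finset_sphere_net (E := EuclideanSpace ℝ (Fin n)) hε0
  rw [finrank_euclideanSpace_fin] at hcard
  have hbad := hS.measure_bad_design_le hM hXy hr0 s hs1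
  have hbad' : (s.card : ℝ) * (2 * Real.exp (-(η * r / 4))) ≤ 2 * Real.exp (-n) := by
    have h1 : (1 + 2 / ε) ^ n = Real.exp (n * Real.log (1 + 2 / ε)) := by
      rw [Real.exp_nat_mul, Real.exp_log (by positivity)]
    calc _ ≤ (1 + 2 / ε) ^ n * (2 * Real.exp (-(η * r / 4))) := by gcongr
      _ = 2 * Real.exp (n * Real.log (1 + 2 / ε) - η * r / 4) := by
          rw [h1, sub_eq_add_neg, Real.exp_add]; ring
      _ ≤ _ := by
          gcongr
          linarith
  have hbady := hS.measure_sum_sq_ge_le hM hXy hy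
  set G := {ω | |risk Q X y (sampleEstimator Xs ys ω) / risk Q X y 0 - 1| ≤
    (36 * T ^ 2 + 12 * T) * √(n / r)} with hG
  set D := ⋃ c ∈ s, ({ω | κ * (covMatrix Q X).trace ≤ ‖∑ i, c i • Xs i ω‖ ^ 2} ∪
    {ω | ‖∑ i, c i • Xs i ω‖ ^ 2 ≤ (covMatrix Q X).trace / 4}) with hD
  set Y := {ω | 2 * T ^ 2 * (∫ ω, y ω ^ 2 ∂Q) * n ≤ ∑ i, ys i ω ^ 2} with hY
  -- Covering the whole space and using subadditivity avoids any measurability question about the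
  -- estimator or the event `G`.
  have hcover : Set.univ ⊆ G ∪ (D ∪ Y) := by
    intro ω _
    by_cases hDY : ω ∈ D ∪ Y
    · exact Or.inr hDY
    left
    simp only [hD, hY, Set.mem_union, Set.mem_iUnion, Set.mem_ofPred_eq, not_or, not_exists,
      not_le] at hDY
    obtain ⟨h1, h2⟩ := hDY
    have hest := norm_sq_sampleEstimator_le hκ1 htr hnet (fun c hc => (h1 c hc).1.le)
      (fun c hc => (h1 c hc).2.le) h2.le
    have hnr : 0 < n / r := by positivity
    have hN := norm_pos_of_effectiveRank_pos hr0
    -- The estimate `hest` gives the constant `16 · 2T² = 32T²`, rounded up to the square `36T² =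
    -- (6T)²`.
    have hrisk := hXy.abs_risk_div_sub_one_le hM hy (α := sampleEstimator Xs ys ω)
      (a := 6 * T * √(n / r)) (by positivity) (by
        rw [mul_pow, mul_pow, Real.sq_sqrt hnr.le, hr, effectiveRank]
        set N := ‖Matrix.toEuclideanCLM (𝕜 := ℝ) (covMatrix Q X)‖
        set t := (covMatrix Q X).trace
        set σ2 := ∫ ω, y ω ^ 2 ∂Q
        set z := ‖sampleEstimator Xs ys ω‖ ^ 2
        rw [show 6 ^ 2 * T ^ 2 * (n / (t / N)) * σ2 = N * (36 * T ^ 2 * n * σ2 / t) by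
          field_simp; norm_num]
        gcongr
        rw [le_div_iff₀ htr]
        have : 0 < T ^ 2 * n * σ2 := by positivity
        linarith)
    refine hrisk.trans ?_
    have hsq1 : √(n / r) ≤ 1 := Real.sqrt_le_one.mpr ((div_le_one hr0).mpr hrn.le)
    have hsq0 : 0 ≤ √(n / r) := Real.sqrt_nonneg _
    have : √(n / r) ^ 2 ≤ √(n / r) := by nlinarith
    nlinarith [sq_nonneg T]
  have hone : 1 ≤ P.real G + (P.real D + P.real Y) := by
    calc 1 = P.real Set.univ := by simp
      _ ≤ P.real (G ∪ (D ∪ Y)) := measureReal_mono hcover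
      _ ≤ P.real G + P.real (D ∪ Y) := measureReal_union_le _ _
      _ ≤ _ := by gcongr; exact measureReal_union_le _ _
  rw [one_mul]
  linarith [hbad.trans hbad']

/-! ### The asymptotic consequence -/

theorem tendsto_sqrt_div_zero {a b : ℕ → ℝ} (h : Tendsto (fun k => b k / a k) atTop atTop) :
    Tendsto (fun k => √(a k / b k)) atTop (𝓝 0) := by
  have h1 := h.inv_tendsto_atTop
  have h2 : Tendsto (fun k => a k / b k) atTop (𝓝 0) := by
    refine h1.congr fun k => ?_
    simp
  simpa using h2.sqrt

end NullRisk

theorem mainTheorem2 (M : ℝ) (hM : 0 < M) :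
    -- the finite-sample bound; the constants depend only on the bound `M` on the ψ₂-norms
    (∃ C c c' K : ℝ, 1 < C ∧ 0 < c ∧ 0 < c' ∧ 0 < K ∧
      ∀ (n p : ℕ) (Ω₀ : Type u) (Ω : Type v) [MeasurableSpace Ω₀] [MeasurableSpace Ω]
        (Q : Measure Ω₀) (P : Measure Ω) [IsProbabilityMeasure Q] [IsProbabilityMeasure P]
        (X : Ω₀ → EuclideanSpace ℝ (Fin p)) (y : Ω₀ → ℝ)
        (Xs : Fin n → Ω → EuclideanSpace ℝ (Fin p)) (ys : Fin n → Ω → ℝ),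
        NullRisk.SubGaussianPair Q M X y →
        0 < ∫ ω, y ω ^ 2 ∂Q →
        NullRisk.IsIIDSample Q X y P Xs ys →
        C * n < NullRisk.effectiveRank (NullRisk.covMatrix Q X) →
        1 - c * Real.exp (-(c' * n)) ≤
          P.real {ω | |NullRisk.risk Q X y (NullRisk.sampleEstimator Xs ys ω) /
              NullRisk.risk Q X y 0 - 1| ≤
            K * √(n / NullRisk.effectiveRank (NullRisk.covMatrix Q X))}) ∧
    -- the asymptotic consequence: the risk ratio tends to one in probability along every sequence
    -- of such problems with `n → ∞` and effective rank of larger order than `n`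
    (∀ (n p : ℕ → ℕ) (Ω₀ : ℕ → Type u) (Ω : ℕ → Type v)
        [∀ k, MeasurableSpace (Ω₀ k)] [∀ k, MeasurableSpace (Ω k)]
        (Q : ∀ k, Measure (Ω₀ k)) (P : ∀ k, Measure (Ω k))
        [∀ k, IsProbabilityMeasure (Q k)] [∀ k, IsProbabilityMeasure (P k)]
        (X : ∀ k, Ω₀ k → EuclideanSpace ℝ (Fin (p k))) (y : ∀ k, Ω₀ k → ℝ)
        (Xs : ∀ k, Fin (n k) → Ω k → EuclideanSpace ℝ (Fin (p k)))
        (ys : ∀ k, Fin (n k) → Ω k → ℝ),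
        (∀ k, NullRisk.SubGaussianPair (Q k) M (X k) (y k)) →
        (∀ k, 0 < ∫ ω, y k ω ^ 2 ∂(Q k)) →
        (∀ k, NullRisk.IsIIDSample (Q k) (X k) (y k) (P k) (Xs k) (ys k)) →
        Tendsto n atTop atTop →
        Tendsto (fun k => NullRisk.effectiveRank (NullRisk.covMatrix (Q k) (X k)) / (n k : ℝ))
          atTop atTop →
        ∀ ε : ℝ, 0 < ε →
          Tendsto (fun k => (P k).real {ω |
              |NullRisk.risk (Q k) (X k) (y k) (NullRisk.sampleEstimator (Xs k) (ys k) ω) /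
                NullRisk.risk (Q k) (X k) (y k) 0 - 1| < ε})
            atTop (𝓝 1)) := by
  have hmain := NullRisk.exists_finite_sample_bound.{u, v} hM
  refine ⟨hmain, ?_⟩
  obtain ⟨C, c, c', K, hC, hc, hc', hK, hbound⟩ := hmain
  intro n p Ω₀ Ω _ _ Q P _ _ X y Xs ys hXy hy hS hn hr ε hε
  have hsqrt : Tendsto (fun k => K * √((n k : ℝ) / NullRisk.effectiveRank
      (NullRisk.covMatrix (Q k) (X k)))) atTop (𝓝 0) := by
    simpa using (NullRisk.tendsto_sqrt_div_zero hr).const_mul K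
  have hnR : Tendsto (fun k => (n k : ℝ)) atTop atTop := tendsto_natCast_atTop_atTop.comp hn
  have hlow : Tendsto (fun k => 1 - c * Real.exp (-(c' * n k))) atTop (𝓝 1) := by
    have h : Tendsto (fun k => Real.exp (-(c' * n k))) atTop (𝓝 0) :=
      Real.tendsto_exp_neg_atTop_nhds_zero.comp (hnR.const_mul_atTop hc')
    simpa using (h.const_mul c).const_sub 1
  refine tendsto_of_tendsto_of_tendsto_of_le_of_le' hlow tendsto_const_nhds ?_
    (Eventually.of_forall fun k => measureReal_le_one)
  -- For large `k` the sample size is positive, which allows clearing the denominator in `r_e / n >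
  -- C`, and the deviation bound falls below `ε`, so the event of the finite-sample bound lies
  -- inside the target event.
  filter_upwards [hr.eventually_gt_atTop C, hn.eventually_gt_atTop 0,
    hsqrt.eventually_lt_const hε] with k hCk hnk hεk
  have hnk' : (0 : ℝ) < n k := by exact_mod_cast hnk
  refine (hbound (n k) (p k) (Ω₀ k) (Ω k) (Q k) (P k) (X k) (y k) (Xs k) (ys k) (hXy k) (hy k)
    (hS k) ((lt_div_iff₀ hnk').mp hCk)).trans (measureReal_mono fun ω hω => ?_)
  exact lt_of_le_of_lt hω hεk
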